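/- **Setting.** Let $f(U)_x=a(U,x)$ on $(x_L,x_R)$ be the steady form of a system of $n$ conservation laws, where the states lie in an open set $D\subset\mathbb R^n$, $f\in C^1(D)$, and $\nabla f(U)$ has real distinct eigenvalues $\lambda_1(U)<\dots<\lambda_n(U)$ for $U\in D$. The boundary conditions are $U(x_L)=U_L^{\alpha}$, with free parameters $\alpha=(\alpha_1,\dots,\alpha_I)\in\mathbb R^I$, and $B_R(U(x_R))=0$ with $B_R:\mathbb R^n\to\mathbb R^{I+1}$. A *single-shock solution* of this problem consists of parameters $\alpha$, a location $x_S\in(x_L,x_R)$, and $C^1$ solutions $U_-$ on $[x_L,x_S]$ and $U_+$ on $[x_S,x_R]$ of the equation which satisfy the boundary conditions and form a stationary Lax shock at $x_S$: $f(U_+)=f(U_-)$ and, for some $k$, $\lambda_k(U_+)<0<\lambda_k(U_-)$ and $\lambda_{k-1}(U_-)<0<\lambda_{k+1}(U_+)$. Assume that the problem is well-posed: * (A1) There is a unique single-shock solution $U^{ex}$, with parameters $\alpha^{ex}$ and shock at $x_S^{ex}$. At $x_L$ exactly its first $I$ eigenvalues are negative and the others positive; at $x_R$ exactly the first $I+1$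 are negative and the others positive. It is Lipschitz stable in $L^1$: there is $C$ such that any two single-shock solutions $U_1,U_2$ of the problems with right boundary conditions $B_R(U)=b_1$ and $B_R(U)=b_2$, whose parameters $\alpha$, shock locations and states $U_+(x_S)$ are close enough to those of $U^{ex}$, satisfy $\|U_1-U_2\|_{L^1(x_L,x_R)}\le C|b_1-b_2|$. * (A2) $f$ is a $C^{1,1}$ diffeomorphism near $U^{ex}(x)$, and $a$ is Lipschitz near $(U^{ex}(x),x)$ in $\mathbb R^n\times[x_L,x_R]$, for every $x\in[x_L,x_R]$ (at $x_S^{ex}$ for both one-sided states). In particular there are no sonic points. * (A3) $U^{ex}_+(x_S^{ex})$ is the only state that forms a Lax shock with $U^{ex}_-(x_S^{ex})$ on its left. * (A4) $\alpha\mapsto U_L^\alpha$ is Lipschitz and injective near $\alpha^{ex}$, and $B_R$ is Lipschitz near $U^{ex}(x_R)$. Let $P_{x_1x_2}U_0=U(x_2)$, where $U$ is the solution of $f(U)_x=a(U,x)$, $U(x_1)=U_0$, and let $\Phi U_-$ be the state on the right of a Lax shock with left state $U_-$ (if there are several, the one closest to $U^{ex}_+(x_S^{ex})$). Let $p>0$,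 and let $P^h_{x_1x_2}$ and $\Phi^h$ ($h>0$) be discrete operators such that, near the exact solution and for all small $h$, * they have accuracy of order $h^p$: $|\Phi^hU-\Phi U|\le Kh^p$ for $U$ near $U^{ex}_-(x^{ex}_S)$; $|P^h_{x_Lx}U-P_{x_Lx}U|\le Kh^p$ for $U$ near $U^{ex}(x_L)$ and $x_L\le x\le x_S^{ex}+\delta$; and $|P^h_{x_1x_2}U-P_{x_1x_2}U|\le Kh^p$ for $U$ near $U^{ex}_+(x_S^{ex})$, $x_1$ near $x_S^{ex}$ and $x_1\le x_2\le x_R$; * they are Lipschitz in the unknowns, with constants that may depend on $h$: $(x,U)\mapsto P^h_{x_Lx}U$ near $(x_S^{ex},U^{ex}(x_L))$, $\Phi^h$ near $U^{ex}_-(x_S^{ex})$, and $(x,U)\mapsto P^h_{x\,x_R}U$ near $(x_S^{ex},U^{ex}_+(x_S^{ex}))$. (Computed branches are measurable in $x$. No other consistency or stability property of the discretization is required.) **Theorem (existence of a discrete solution).** There are a constant $C$ and $h_1>0$ such that for every $h\in(0,h_1)$ the discrete shooting problem $$G^h(y)\equiv B_R\left(P^h_{x_Sx_R}\Phi^hP^h_{x_Lx_S}U_L^{\alpha}\right)=0,\qquad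 y=(\alpha,x_S),$$ has a solution $y^h=(\alpha^h,x_S^h)$ with $x_S^h\in(x_L,x_R)$, and each component $u^h$ of the computed solution $$U^h(x)=\begin{cases}P^h_{x_Lx}U_L^{\alpha^h},&x_L<x\le x_S^h,\\ P^h_{x_S^hx}\Phi^hP^h_{x_Lx_S^h}U_L^{\alpha^h},&x_S^h<x\le x_R,\end{cases}$$ satisfies $\|u^{ex}-u^h\|_{L^1(x_L,x_R)}\le Ch^p$, where $u^{ex}$ is the corresponding component of $U^{ex}$. The same bound holds, for the same $y^h$, if $P^h,\Phi^h$ are replaced by $P,\Phi$ in the formula for $U^h$. -/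

import Mathlib

open Set Filter Topology MeasureTheory

/-- Vectors of `ℝⁿ` with the Euclidean norm. -/
abbrev Vec (n : ℕ) : Type := EuclideanSpace ℝ (Fin n)

/-- `l` lists the eigenvalues `λ₁ < ⋯ < λₙ` of `A`: they are real and distinct. -/
def IsOrderedSpectrum {n : ℕ} (A : Vec n →L[ℝ] Vec n) (l : Fin n → ℝ) : Prop :=
  StrictMono l ∧ ∀ i, Module.End.HasEigenvalue (A : Vec n →ₗ[ℝ] Vec n) (l i)

/-- `g` is of class `C^{1,1}` on `s`: differentiable with Lipschitz derivative. -/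
def IsC11On {n : ℕ} (g : Vec n → Vec n) (s : Set (Vec n)) : Prop :=
  DifferentiableOn ℝ g s ∧ ∃ K, LipschitzOnWith K (fderiv ℝ g) s

/-- `g` restricts to a `C^{1,1}` diffeomorphism of a neighbourhood of `U` onto an open set. -/
def IsC11DiffeoNear {n : ℕ} (g : Vec n → Vec n) (U : Vec n) : Prop :=
  ∃ φ : OpenPartialHomeomorph (Vec n) (Vec n), U ∈ φ.source ∧ EqOn g φ φ.source ∧
    IsC11On g φ.source ∧ IsC11On φ.symm φ.target

/-- The function equal to `Um` up to `xS` and to `Up` behind it. -/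
noncomputable def twoStates {n : ℕ} (xS : ℝ) (Um Up : ℝ → Vec n) (x : ℝ) : Vec n :=
  if x ≤ xS then Um x else Up x

/-- The data of the steady problem `f(U)_x = a(U,x)` on `(xL, xR)`, `U(xL) = UL α` with `I` free
parameters `α`, and `J = I + 1` conditions `BR (U(xR)) = 0`, for a strictly hyperbolic system of
`n` equations with states in the open set `D`. -/
structure SteadyProblem (n I : ℕ) where
  D : Set (Vec n)
  isOpen_D : IsOpen D
  f : Vec n → Vec n
  contDiffOn_f : ContDiffOn ℝ 1 f D
  hyperbolic : ∀ U ∈ D, ∃ l, IsOrderedSpectrum (fderiv ℝ f U) l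
  a : Vec n → ℝ → Vec n
  xL : ℝ
  xR : ℝ
  xL_lt_xR : xL < xR
  UL : Vec I → Vec n
  BR : Vec n → Vec (I + 1)

namespace SteadyProblem

variable {n I : ℕ} (P : SteadyProblem n I)

/-- `U` is a `C¹` solution of `f(U)_x = a(U,x)` on `[x₁, x₂]`. -/
structure IsBranch (x₁ x₂ : ℝ) (U : ℝ → Vec n) : Prop where
  contDiffOn : ContDiffOn ℝ 1 U (Icc x₁ x₂)
  mem_D : ∀ x ∈ Icc x₁ x₂, U x ∈ P.D
  ode : ∀ x ∈ Ioo x₁ x₂, HasDerivAt (fun t => P.f (U t)) (P.a (U x) x) x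

/-- `U` on the left and `V` on the right form a stationary Lax shock: the Rankine–Hugoniot
condition and, for some `k`, the Lax inequalities
`λ_k(V) < 0 < λ_k(U)`, `λ_{k-1}(U) < 0 < λ_{k+1}(V)`. -/
def IsLaxShock (U V : Vec n) : Prop :=
  U ∈ P.D ∧ V ∈ P.D ∧ P.f V = P.f U ∧
    ∃ (lU lV : Fin n → ℝ) (k : Fin n),
      IsOrderedSpectrum (fderiv ℝ P.f U) lU ∧ IsOrderedSpectrum (fderiv ℝ P.f V) lV ∧
      lV k < 0 ∧ 0 < lU k ∧ (∀ j < k, lU j < 0) ∧ (∀ j > k, 0 < lV j)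

/-- `Um` on `[xL, xS]` and `Up` on `[xS, xR]` form a solution with a single Lax shock, at `xS`, of
the problem with left parameters `α` and right boundary condition `BR (U(xR)) = b`. -/
structure IsShockSolution (b : Vec (I + 1)) (α : Vec I) (xS : ℝ) (Um Up : ℝ → Vec n) : Prop where
  mem_Ioo : xS ∈ Ioo P.xL P.xR
  left : P.IsBranch P.xL xS Um
  left_bc : Um P.xL = P.UL α
  lax : P.IsLaxShock (Um xS) (Up xS)
  right : P.IsBranch xS P.xR Up
  right_bc : P.BR (Up P.xR) = b

/-- Lipschitz stability in `L¹(xL, xR)` of the solution under perturbations of the boundary data: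
single-shock solutions near the given one, with right data `b₁`, `b₂`, satisfy
`‖U₁ - U₂‖_{L¹} ≤ C ‖b₁ - b₂‖`. -/
def IsL1Stable (α : Vec I) (xS : ℝ) (Up : ℝ → Vec n) : Prop :=
  ∃ C δ : ℝ, 0 < δ ∧
    ∀ (b₁ b₂ : Vec (I + 1)) (α₁ α₂ : Vec I) (x₁ x₂ : ℝ) (Um₁ Up₁ Um₂ Up₂ : ℝ → Vec n),
      P.IsShockSolution b₁ α₁ x₁ Um₁ Up₁ → P.IsShockSolution b₂ α₂ x₂ Um₂ Up₂ →
      ‖α₁ - α‖ < δ → |x₁ - xS| < δ → ‖Up₁ x₁ - Up xS‖ < δ →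
      ‖α₂ - α‖ < δ → |x₂ - xS| < δ → ‖Up₂ x₂ - Up xS‖ < δ →
      eLpNorm (fun x => twoStates x₁ Um₁ Up₁ x - twoStates x₂ Um₂ Up₂ x) 1
        (volume.restrict (Ioo P.xL P.xR)) ≤ ENNReal.ofReal (C * ‖b₁ - b₂‖)

/-- The problem is well-posed, with exact solution given by `Um`, `Up`, the shock location `xS` and
the left parameters `α`. -/
structure WellPosed (α : Vec I) (xS : ℝ) (Um Up : ℝ → Vec n) : Prop where
  /-- existence -/
  sol : P.IsShockSolution 0 α xS Um Up
  /-- at `xL` exactly the first `I` eigenvalues are negative, the others are positive -/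
  signs_left : ∀ l, IsOrderedSpectrum (fderiv ℝ P.f (Um P.xL)) l →
    ∀ i : Fin n, (i.val < I → l i < 0) ∧ (I ≤ i.val → 0 < l i)
  /-- at `xR` exactly the first `I + 1` eigenvalues are negative, the others are positive -/
  signs_right : ∀ l, IsOrderedSpectrum (fderiv ℝ P.f (Up P.xR)) l →
    ∀ i : Fin n, (i.val < I + 1 → l i < 0) ∧ (I + 1 ≤ i.val → 0 < l i)
  /-- uniqueness -/
  unique : ∀ α' xS' Um' Up', P.IsShockSolution 0 α' xS' Um' Up' →
    EqOn (twoStates xS' Um' Up') (twoStates xS Um Up) (Icc P.xL P.xR)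
  /-- stability -/
  stable : P.IsL1Stable α xS Up
  /-- the flux is a local diffeomorphism along both states (so there are no sonic points) -/
  flux_left : ∀ x ∈ Icc P.xL xS, IsC11DiffeoNear P.f (Um x)
  flux_right : ∀ x ∈ Icc xS P.xR, IsC11DiffeoNear P.f (Up x)
  /-- the source is Lipschitz near both states -/
  source_left : ∀ x ∈ Icc P.xL xS, ∃ s ∈ 𝓝[univ ×ˢ Icc P.xL P.xR] (Um x, x), ∃ K,
    LipschitzOnWith K (Function.uncurry P.a) s
  source_right : ∀ x ∈ Icc xS P.xR, ∃ s ∈ 𝓝[univ ×ˢ Icc P.xL P.xR] (Up x, x), ∃ K,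
    LipschitzOnWith K (Function.uncurry P.a) s
  /-- the state behind the shock is the only one that the Lax conditions admit -/
  jump_unique : ∀ V, P.IsLaxShock (Um xS) V → V = Up xS
  /-- the boundary functions are Lipschitz -/
  UL_lipschitz : ∃ s ∈ 𝓝 α, ∃ K, LipschitzOnWith K P.UL s
  BR_lipschitz : ∃ s ∈ 𝓝 (Up P.xR), ∃ K, LipschitzOnWith K P.BR s
  /-- `α₁, …, α_I` are independent parameters of the left boundary state -/
  UL_injOn : ∃ s ∈ 𝓝 α, InjOn P.UL s

open Classical in
/-- The propagation operator: the value at `x₂` of the solution of `f(U)_x = a(U,x)`,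
`U(x₁) = U₀` (and `U₀` if there is none). -/
noncomputable def propagate (x₁ x₂ : ℝ) (U₀ : Vec n) : Vec n :=
  if h : ∃ U : ℝ → Vec n, P.IsBranch x₁ x₂ U ∧ U x₁ = U₀ then h.choose x₂ else U₀

open Classical in
/-- The jump operator: the state behind a Lax shock with the state `U` in front of it. Should there
be several, it is the one closest to the reference state `V₀`, for which we take the exact state
behind the shock. -/
noncomputable def jump (V₀ U : Vec n) : Vec n :=
  if h : ∃ V, P.IsLaxShock U V ∧ ∀ V', P.IsLaxShock U V' → dist V V₀ ≤ dist V' V₀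
    then h.choose else V₀

/-- The shooting function `y = (α, x_S) ↦ BR (p_{x_S xR} (φ (p_{xL x_S} (UL α))))` for a
propagation operator `p` and a jump operator `φ`. -/
def shoot (p : ℝ → ℝ → Vec n → Vec n) (φ : Vec n → Vec n) (y : Vec I × ℝ) : Vec (I + 1) :=
  P.BR (p y.2 P.xR (φ (p P.xL y.2 (P.UL y.1))))

/-- The function on `(xL, xR]` that the operators `p` and `φ` build from `y = (α, x_S)`. -/
noncomputable def profile (p : ℝ → ℝ → Vec n → Vec n) (φ : Vec n → Vec n) (y : Vec I × ℝ) :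
    ℝ → Vec n :=
  twoStates y.2 (fun x => p P.xL x (P.UL y.1))
    (fun x => p y.2 x (φ (p P.xL y.2 (P.UL y.1))))

/-- The discrete propagation operators `Ph h` and jump operators `Φh h` (`h > 0` small) are
Lipschitz near the exact solution, with constants that may depend on `h`, and approximate the
continuous ones there to order `h ^ k`. -/
def IsApproximation (xS : ℝ) (Um Up : ℝ → Vec n) (k : ℝ)
    (Ph : ℝ → ℝ → ℝ → Vec n → Vec n) (Φh : ℝ → Vec n → Vec n) : Prop :=
  ∃ δ h₀ K : ℝ, 0 < δ ∧ 0 < h₀ ∧ ∀ h ∈ Ioo 0 h₀,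
    -- accuracy
    (∀ x ∈ Icc P.xL (xS + δ), ∀ U ∈ Metric.ball (Um P.xL) δ,
      ‖Ph h P.xL x U - P.propagate P.xL x U‖ ≤ K * h ^ k) ∧
    (∀ U ∈ Metric.ball (Um xS) δ, ‖Φh h U - P.jump (Up xS) U‖ ≤ K * h ^ k) ∧
    (∀ x₁ ∈ Icc (xS - δ) (xS + δ), ∀ x₂ ∈ Icc x₁ P.xR, ∀ U ∈ Metric.ball (Up xS) δ,
      ‖Ph h x₁ x₂ U - P.propagate x₁ x₂ U‖ ≤ K * h ^ k) ∧
    -- Lipschitz dependence on the unknowns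
    (∃ L, LipschitzOnWith L (fun q : ℝ × Vec n => Ph h P.xL q.1 q.2)
      (Icc (xS - δ) (xS + δ) ×ˢ Metric.ball (Um P.xL) δ)) ∧
    (∃ L, LipschitzOnWith L (Φh h) (Metric.ball (Um xS) δ)) ∧
    (∃ L, LipschitzOnWith L (fun q : ℝ × Vec n => Ph h q.1 P.xR q.2)
      (Icc (xS - δ) (xS + δ) ×ˢ Metric.ball (Up xS) δ)) ∧
    -- the computed branches are measurable functions of the end point
    (∀ U ∈ Metric.ball (Um P.xL) δ, AEStronglyMeasurable (fun x => Ph h P.xL x U)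
      (volume.restrict (Icc P.xL (xS + δ)))) ∧
    (∀ x₁ ∈ Icc (xS - δ) (xS + δ), ∀ U ∈ Metric.ball (Up xS) δ,
      AEStronglyMeasurable (fun x => Ph h x₁ x U) (volume.restrict (Icc x₁ P.xR)))

end SteadyProblem

/-! The shooting function `G(α, x_S)` has as many unknowns as equations, namely `I + 1`, and near
the exact parameters each value `b = G(y)` is the right boundary datum of a genuine single-shock
solution with parameters `y`. Stability in `L¹` can therefore replace any information on derivatives
of `G`. If `G(y) = G(y')`, the two solutions agree almost everywhere; the jump at the shock then
fixes `x_S`, and the left boundary state fixes `α`. So `G` is injective near the exact parameters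
(`injOn_shoot`).

By invariance of domain (`image_closedBall_mem_nhds`), the continuous injective map `G` covers a
ball of some radius `ε` about `0` and has a continuous inverse `g` there. If `G^h` is continuous and
within `ε` of `G`, then `z ↦ z - G^h(g(z))` maps this ball into itself, and a Brouwer fixed point
gives a zero of `G^h` (`exists_zero_of_near_injOn`). That `G^h - G` is of order `h ^ k` follows from
the accuracy of the discrete operators and the Lipschitz constants of the exact ones (`perturb`).
The Lipschitz constants of the discrete operators may blow up with `h`, since they serve only for
continuity.

At the zero `y^h` the value `G(y^h) = G(y^h) - G^h(y^h)` is of order `h ^ k`. Stability then bounds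
the `L¹` distance between the exact solution and the single-shock solution with parameters `y^h`,
and the discrete profile with the same parameters is uniformly close to the latter. No estimate of
`y^h - y^ex` is needed.

Brouwer's theorem is derived from integrals of Jacobians of Lipschitz maps. The exact operators are
controlled through a globally Lipschitz extension of the velocity field `(f')⁻¹ a` (`exists_flow`)
and through the persistence of eigenvalue signs (`IsLaxShock.exists_jump`). -/

section Jacobian

/-! ### Mean Jacobian of a Lipschitz perturbation of the identity. -/

variable {E : Type*} [NormedAddCommGroup E] [InnerProductSpace ℝ E]

/-- Along the segment `1 + s A`, `0 ≤ s ≤ 1`, the operator stays invertible by the Neumann series,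
so the determinant cannot change sign on its way from the value `1` at `s = 0`. -/
theorem ContinuousLinearMap.det_one_add_pos [CompleteSpace E] {A : E →L[ℝ] E} (hA : ‖A‖ < 1) :
    0 < (1 + A).det := by
  have hc : Continuous fun s : ℝ => (1 + s • A).det :=
    ContinuousLinearMap.continuous_det.comp (by fun_prop)
  have hne : ∀ s ∈ Icc (0 : ℝ) 1, (1 + s • A).det ≠ 0 := by
    intro s hs h0
    have hu : IsUnit (1 + s • A) := by
      have : ‖-(s • A)‖ < 1 := by
        rw [norm_neg, norm_smul, Real.norm_eq_abs, abs_of_nonneg hs.1]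
        nlinarith [hs.2, norm_nonneg A]
      simpa using isUnit_one_sub_of_norm_lt_one this
    have := hu.map (ContinuousLinearMap.toLinearMapRingHom : (E →L[ℝ] E) →+* (E →ₗ[ℝ] E))
    have := LinearMap.isUnit_det _ this
    exact this.ne_zero h0
  by_contra! hle
  have h1 : (0 : ℝ) ∈ Icc ((1 + (1 : ℝ) • A).det) ((1 + (0 : ℝ) • A).det) := by
    constructor
    · simpa using hle
    · have : (1 : E →L[ℝ] E).det = 1 := by
        simp [ContinuousLinearMap.det]
      simp [this]
  obtain ⟨s, hs, hs0⟩ := intermediate_value_Icc' zero_le_one hc.continuousOn h1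
  exact hne s hs hs0

variable [FiniteDimensional ℝ E]

/-- `t ↦ det (1 + t A)` is a polynomial of degree at most `dim E`, so that its value at `1` is a
fixed combination of its values at other points. -/
theorem ContinuousLinearMap.exists_det_one_add_eq_sum {ε : ℝ} (hε : 0 < ε) :
    ∃ (m : ℕ) (w t : ℕ → ℝ), (∀ i, t i ∈ Icc 0 ε) ∧ ∑ i ∈ Finset.range m, w i = 1 ∧
      ∀ A : E →L[ℝ] E, (1 + A).det = ∑ i ∈ Finset.range m, w i * (1 + t i • A).det := by
  classical
  let d := Module.finrank ℝ E
  let t : ℕ → ℝ := fun i => ε / (i + 1)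
  have ht : Function.Injective t := by
    intro i j hij
    simp only [t] at hij
    field_simp at hij
    exact_mod_cast (by linarith : (i : ℝ) = j)
  let S := Finset.range (d + 1)
  -- Lagrange interpolation at `dim E + 1` distinct nodes in `[0, ε]`, evaluated at `1`; the weights
  -- sum to one because the basis polynomials do.
  refine ⟨d + 1, fun i => (Lagrange.basis S t i).eval 1, t, fun i => ⟨by positivity, ?_⟩, ?_, ?_⟩
  · exact div_le_self hε.le (by linarith [(Nat.cast_nonneg i : (0 : ℝ) ≤ i)])
  · rw [← Polynomial.eval_finsetSum, Lagrange.sum_basis ht.injOn (by simp)]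
    simp
  · intro A
    let b := Module.finBasis ℝ E
    let M := LinearMap.toMatrix b b (A : E →ₗ[ℝ] E)
    let p : Polynomial ℝ := Matrix.det
      ((Polynomial.X : Polynomial ℝ) • M.map Polynomial.C + (1 : Matrix _ _ ℝ).map Polynomial.C)
    have hp : ∀ s : ℝ, p.eval s = (1 + s • A).det := by
      intro s
      rw [ContinuousLinearMap.det, ← LinearMap.det_toMatrix b]
      simp only [p]
      rw [← Polynomial.coe_evalRingHom, RingHom.map_det]
      congr 1
      ext i j
      simp [M, add_comm, LinearMap.toMatrix_apply, Matrix.one_apply, Finsupp.single_apply,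
        eq_comm (a := j), mul_comm s]
      split_ifs <;> simp
    have hdeg : p.degree < S.card := by
      have := Polynomial.natDegree_det_X_add_C_le M 1
      rw [Fintype.card_fin] at this
      refine lt_of_le_of_lt Polynomial.degree_le_natDegree ?_
      simp only [S, Finset.card_range]
      exact_mod_cast Nat.lt_succ_of_le this
    have := congrArg (Polynomial.eval 1) (Lagrange.eq_interpolate ht.injOn hdeg)
    rw [hp, one_smul, Lagrange.interpolate_apply, Polynomial.eval_finsetSum] at this
    rw [this]
    refine Finset.sum_congr rfl fun i _ => ?_
    rw [Polynomial.eval_mul, Polynomial.eval_C, hp, mul_comm]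

variable [MeasurableSpace E] [BorelSpace E]

/-- A Lipschitz map preserves null sets. -/
theorem LipschitzOnWith.addHaar_image_eq_zero (μ : Measure E) [μ.IsAddHaarMeasure] {f : E → E}
    {C : NNReal} {s : Set E} (hf : LipschitzOnWith C f s) (hs : μ s = 0) : μ (f '' s) = 0 := by
  let ν : Measure E := Measure.hausdorffMeasure (Module.finrank ℝ E)
  have hμν : μ ≪ ν := Measure.absolutelyContinuous_isAddHaarMeasure μ ν
  have hνμ : ν ≪ μ := Measure.absolutelyContinuous_isAddHaarMeasure ν μ
  apply hμν
  have := hf.hausdorffMeasure_image_le (d := Module.finrank ℝ E) (Nat.cast_nonneg _)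
  rw [show Measure.hausdorffMeasure (Module.finrank ℝ E : ℝ) s = 0 from hνμ hs, mul_zero] at this
  exact le_antisymm this bot_le

/-- For such small `t` the map `x + t g(x)` is a bijection of the space with positive Jacobian and
maps `s` onto itself, so the change of variables formula yields the volume of `s`. -/
theorem setIntegral_det_one_add_smul_fderiv (μ : Measure E) [μ.IsAddHaarMeasure] {g : E → E}
    {C : NNReal} (hg : LipschitzWith C g) {s : Set E} (hs : MeasurableSet s) (hμs : μ s ≠ ⊤)
    (hgs : ∀ x ∉ s, g x = 0) {t : ℝ} (ht0 : 0 ≤ t) (ht : t * C < 1) :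
    IntegrableOn (fun x => (1 + t • fderiv ℝ g x).det) s μ ∧
      ∫ x in s, (1 + t • fderiv ℝ g x).det ∂μ = μ.real s := by
  let F : E → E := fun x => x + t • g x
  have hFl : LipschitzWith (1 + t.toNNReal * C) F := by
    refine LipschitzWith.id.add (LipschitzWith.of_dist_le_mul fun x y => ?_)
    rw [dist_smul₀, Real.norm_eq_abs, abs_of_nonneg ht0, NNReal.coe_mul, Real.coe_toNNReal t ht0,
      mul_assoc]
    gcongr
    exact hg.dist_le_mul x y
  have happ : ApproximatesLinearOn F ((ContinuousLinearEquiv.refl ℝ E : E ≃L[ℝ] E) : E →L[ℝ] E)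
      univ (t.toNNReal * C) := by
    refine ApproximatesLinearOn.approximatesLinearOn_iff_lipschitzOnWith.2 (lipschitzOnWith_univ.2 ?_)
    refine LipschitzWith.of_dist_le_mul fun x y => ?_
    have : ∀ z, (F - ⇑((ContinuousLinearEquiv.refl ℝ E : E ≃L[ℝ] E) : E →L[ℝ] E)) z = t • g z := by
      intro z; simp [F]
    rw [this, this, dist_smul₀, Real.norm_eq_abs, abs_of_nonneg ht0, NNReal.coe_mul,
      Real.coe_toNNReal t ht0, mul_assoc]
    gcongr
    exact hg.dist_le_mul x y
  have hcond : Subsingleton E ∨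
      t.toNNReal * C < ‖((ContinuousLinearEquiv.refl ℝ E).symm : E →L[ℝ] E)‖₊⁻¹ := by
    rcases subsingleton_or_nontrivial E with h | h
    · exact Or.inl h
    · right
      have : ‖((ContinuousLinearEquiv.refl ℝ E).symm : E →L[ℝ] E)‖₊ = 1 := by
        have : ((ContinuousLinearEquiv.refl ℝ E).symm : E →L[ℝ] E) = ContinuousLinearMap.id ℝ E := by
          ext; simp
        rw [this]
        exact NNReal.eq (by simp)
      rw [this, inv_one, ← NNReal.coe_lt_coe]
      simpa [Real.coe_toNNReal t ht0] using ht
  have hbij : Function.Bijective F := (happ.toHomeomorph F hcond).bijective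
  -- A bijection that fixes every point of the complement of `s` preserves `s`.
  have himg : F '' s = s := by
    have hc : F '' sᶜ = sᶜ := by
      have : EqOn F id sᶜ := fun x hx => by simp [F, hgs x hx]
      rw [this.image_eq, image_id]
    rw [← compl_inj_iff, ← image_compl_eq hbij, hc]
  -- The change of variables needs a derivative at every point; by Rademacher the discarded set is
  -- null, and so is its image under the Lipschitz map `F`.
  let S := s ∩ {x | DifferentiableAt ℝ g x}
  have hS : MeasurableSet S := hs.inter (measurableSet_of_differentiableAt ℝ g)
  have hae : S =ᵐ[μ] s := by
    have := hg.ae_differentiableAt (μ := μ)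
    filter_upwards [this] with x hx
    exact propext ⟨fun h => h.1, fun h => ⟨h, hx⟩⟩
  have hd : ∀ x ∈ S, HasFDerivWithinAt F (1 + t • fderiv ℝ g x) S x := fun x hx =>
    ((hasFDerivAt_id x).add (hx.2.hasFDerivAt.const_smul t)).hasFDerivWithinAt
  have hpos : ∀ x, 0 < (1 + t • fderiv ℝ g x).det := by
    intro x
    apply ContinuousLinearMap.det_one_add_pos
    rw [norm_smul, Real.norm_eq_abs, abs_of_nonneg ht0]
    refine lt_of_le_of_lt ?_ ht
    gcongr
    exact norm_fderiv_le_of_lipschitz ℝ hg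
  have hFS : F '' S =ᵐ[μ] s := by
    have hnull : μ (F '' (s \ S)) = 0 :=
      hFl.lipschitzOnWith.addHaar_image_eq_zero μ (ae_le_set.1 hae.symm.le)
    have : F '' s = F '' S ∪ F '' (s \ S) := by
      rw [← image_union, union_sdiff_cancel inter_subset_left]
    conv_rhs => rw [← himg, this]
    exact (union_ae_eq_left_of_ae_eq_empty (ae_eq_empty.2 hnull)).symm
  have h1 := integral_image_eq_integral_abs_det_fderiv_smul μ hS hd hbij.1.injOn
    (fun _ => (1 : ℝ))
  have h2 := integrableOn_image_iff_integrableOn_abs_det_fderiv_smul μ hS hd hbij.1.injOn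
    (fun _ => (1 : ℝ))
  simp only [smul_eq_mul, mul_one, abs_of_pos (hpos _)] at h1 h2
  rw [setIntegral_congr_set hae] at h1
  rw [integrableOn_congr_set_ae hae, integrableOn_congr_set_ae hFS] at h2
  rw [setIntegral_congr_set hFS] at h1
  refine ⟨h2.1 (integrableOn_const hμs), ?_⟩
  rw [← h1]
  simp

/-- A Lipschitz map that is the identity outside `s` has mean Jacobian determinant one on `s`. -/
theorem setIntegral_det_one_add_fderiv (μ : Measure E) [μ.IsAddHaarMeasure] {g : E → E}
    {C : NNReal} (hg : LipschitzWith C g) {s : Set E} (hs : MeasurableSet s) (hμs : μ s ≠ ⊤)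
    (hgs : ∀ x ∉ s, g x = 0) :
    ∫ x in s, (1 + fderiv ℝ g x).det ∂μ = μ.real s := by
  -- Nodes up to this size satisfy `t i * C < 1`; the value at `1` is then recovered by polynomial
  -- interpolation.
  have hε : (0 : ℝ) < 1 / (C + 1) := by positivity
  obtain ⟨m, w, t, ht, hw, hdet⟩ := ContinuousLinearMap.exists_det_one_add_eq_sum (E := E) hε
  have key : ∀ i, _ := fun i => setIntegral_det_one_add_smul_fderiv μ hg hs hμs hgs (ht i).1 (by
    have h2 : t i * C ≤ 1 / (C + 1) * C := by gcongr; exact (ht i).2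
    refine lt_of_le_of_lt h2 ?_
    rw [one_div, inv_mul_lt_one₀ (by positivity)]
    linarith)
  rw [integral_congr_ae (ae_of_all _ fun x => hdet (fderiv ℝ g x))]
  rw [integral_finsetSum _ fun i _ => (key i).1.const_mul (w i)]
  rw [Finset.sum_congr rfl fun i _ => (integral_const_mul (w i) _).trans
    (congrArg (w i * ·) (key i).2), ← Finset.sum_mul, hw, one_mul]

end Jacobian

/-! ### Brouwer's theorem, invariance of domain, and zeros of perturbed injective maps. -/

section FixedPoint

variable {E : Type*} [NormedAddCommGroup E] [InnerProductSpace ℝ E]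

/-- There is no Lipschitz retraction of a ball onto its boundary sphere. -/
theorem exists_norm_add_ne_of_lipschitzWith [FiniteDimensional ℝ E] {g : E → E} {C : NNReal}
    (hg : LipschitzWith C g) {R : ℝ} (hR : 0 < R) (hgR : ∀ x, R ≤ ‖x‖ → g x = 0) :
    ∃ x, ‖x‖ < R ∧ ‖x + g x‖ ≠ R := by
  by_contra! hr
  borelize E
  let μ : Measure E := Measure.addHaar
  have hgs : ∀ x ∉ Metric.ball (0 : E) R, g x = 0 := fun x hx => hgR x (by simpa using hx)
  have h1 := setIntegral_det_one_add_fderiv μ hg Metric.isOpen_ball.measurableSet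
    measure_ball_lt_top.ne hgs
  have h2 : ∫ x in Metric.ball (0 : E) R, (1 + fderiv ℝ g x).det ∂μ = 0 := by
    refine integral_eq_zero_of_ae ?_
    have := hg.ae_differentiableAt (μ := μ)
    filter_upwards [ae_restrict_of_ae this, ae_restrict_mem Metric.isOpen_ball.measurableSet]
      with x hx hxR
    by_contra hdet
    let A : E →L[ℝ] E := 1 + fderiv ℝ g x
    have hA : HasFDerivAt (fun y => y + g y) A x := (hasFDerivAt_id x).add hx.hasFDerivAt
    -- Differentiating the constant square norm gives `⟪x + g x, A v⟫ = 0` for all `v`. If `A` were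
    -- surjective, `A v = x + g x` would give `R ^ 2 = 0`; so the Jacobian vanishes almost
    -- everywhere, against its mean value one.
    have hconst : (fun y => inner ℝ (y + g y) (y + g y)) =ᶠ[𝓝 x] fun _ => R ^ 2 := by
      filter_upwards [Metric.isOpen_ball.mem_nhds hxR] with y hy
      rw [real_inner_self_eq_norm_sq, hr y (by simpa using hy)]
    have hzero := (hA.inner ℝ hA).unique ((hasFDerivAt_const (R ^ 2) x).congr_of_eventuallyEq hconst)
    have hsurj : Function.Surjective (A : E →ₗ[ℝ] E) := by
      have : IsUnit (A : E →ₗ[ℝ] E) :=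
        (LinearMap.isUnit_iff_isUnit_det _).2 (isUnit_iff_ne_zero.2 hdet)
      exact ((Module.End.isUnit_iff _).1 this).2
    obtain ⟨v, hv⟩ := hsurj (x + g x)
    have hv' : A v = x + g x := hv
    have := congrArg (fun B : E →L[ℝ] ℝ => B v) hzero
    simp only [ContinuousLinearMap.comp_apply, ContinuousLinearMap.prod_apply, hv',
      fderivInnerCLM_apply, zero_apply, real_inner_self_eq_norm_sq] at this
    rw [hr x (by simpa using hxR)] at this
    nlinarith
  have h3 : 0 < μ.real (Metric.ball (0 : E) R) :=
    ENNReal.toReal_pos (Metric.measure_ball_pos μ 0 hR).ne' measure_ball_lt_top.ne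
  linarith

theorem norm_normalize_sub_le {η : ℝ} (hη : 0 < η) {z z' : E} (hz : η ≤ ‖z‖) (hz' : η ≤ ‖z'‖) :
    ‖‖z‖⁻¹ • z - ‖z'‖⁻¹ • z'‖ ≤ 2 / η * ‖z - z'‖ := by
  have h0 : 0 < ‖z‖ := hη.trans_le hz
  have h0' : 0 < ‖z'‖ := hη.trans_le hz'
  have : ‖z‖⁻¹ • z - ‖z'‖⁻¹ • z' = ‖z‖⁻¹ • (z - z') + (‖z‖⁻¹ - ‖z'‖⁻¹) • z' := by
    rw [smul_sub, sub_smul]; abel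
  rw [this]
  have h1 : ‖‖z‖⁻¹ • (z - z')‖ ≤ 1 / η * ‖z - z'‖ := by
    rw [norm_smul, norm_inv, norm_norm, one_div]
    gcongr
  have h2 : ‖(‖z‖⁻¹ - ‖z'‖⁻¹) • z'‖ ≤ 1 / η * ‖z - z'‖ := by
    have : (‖z‖⁻¹ - ‖z'‖⁻¹) = ‖z‖⁻¹ * ((‖z'‖ - ‖z‖) * ‖z'‖⁻¹) := by field_simp
    rw [this, norm_smul, norm_mul, norm_mul, norm_inv, norm_inv, norm_norm, norm_norm, mul_assoc,
      mul_assoc, inv_mul_cancel₀ h0'.ne', mul_one, one_div]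
    have := abs_norm_sub_norm_le z' z
    rw [norm_sub_rev z' z] at this
    rw [Real.norm_eq_abs]
    gcongr
  calc _ ≤ _ := norm_add_le _ _
    _ ≤ 1 / η * ‖z - z'‖ + 1 / η * ‖z - z'‖ := add_le_add h1 h2
    _ = _ := by ring

/-- The vector in question pushes `z` radially out to the sphere of radius `R`. The bound makes the
retraction built from a zero-free map Lipschitz. -/
theorem norm_radial_sub_le {η R : ℝ} (hη : 0 < η) (hR : 0 ≤ R) {z z' : E} (hz : η ≤ ‖z‖)
    (hz' : η ≤ ‖z'‖) :
    ‖max (R - ‖z‖) 0 • (‖z‖⁻¹ • z) - max (R - ‖z'‖) 0 • (‖z'‖⁻¹ • z')‖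
      ≤ (1 + R * (2 / η)) * ‖z - z'‖ := by
  set u := ‖z‖⁻¹ • z
  set u' := ‖z'‖⁻¹ • z'
  set s := max (R - ‖z‖) 0
  set s' := max (R - ‖z'‖) 0
  have hu : ‖u‖ = 1 := by
    simp only [u, norm_smul, norm_inv, norm_norm]
    exact inv_mul_cancel₀ (hη.trans_le hz).ne'
  have hs' : |s'| ≤ R := by
    rw [abs_of_nonneg (le_max_right _ _)]
    exact max_le (by linarith [norm_nonneg z']) hR
  have hss : |s - s'| ≤ ‖z - z'‖ := by
    refine (abs_max_sub_max_le_abs _ _ _).trans ?_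
    rw [show R - ‖z‖ - (R - ‖z'‖) = ‖z'‖ - ‖z‖ by ring, norm_sub_rev]
    exact abs_norm_sub_norm_le _ _
  have : s • u - s' • u' = (s - s') • u + s' • (u - u') := by
    rw [smul_sub, sub_smul]; abel
  rw [this]
  calc _ ≤ ‖(s - s') • u‖ + ‖s' • (u - u')‖ := norm_add_le _ _
    _ = |s - s'| + |s'| * ‖u - u'‖ := by simp [norm_smul, hu]
    _ ≤ ‖z - z'‖ + R * (2 / η * ‖z - z'‖) := by
        gcongr
        exact norm_normalize_sub_le hη hz hz'
    _ = _ := by ring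

variable [FiniteDimensional ℝ E]

/-- A continuous map of a ball into itself which is the identity outside the ball has a zero. -/
theorem exists_eq_zero_of_eq_self_outside {W : E → E} (hW : Continuous W) {R : ℝ} (hR : 0 < R)
    (hout : ∀ x, R ≤ ‖x‖ → W x = x) (hin : ∀ x, ‖x‖ ≤ R → ‖W x‖ ≤ R) : ∃ x, W x = 0 := by
  by_contra! hne
  obtain ⟨x₀, -, hx₀⟩ := (isCompact_closedBall (0 : E) R).exists_isMinOn
    ⟨0, by simpa using hR.le⟩ hW.norm.continuousOn
  set η := min ‖W x₀‖ R with hη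
  have hη0 : 0 < η := lt_min (norm_pos_iff.2 (hne x₀)) hR
  have hWη : ∀ x, η ≤ ‖W x‖ := by
    intro x
    rcases le_total ‖x‖ R with h | h
    · exact (min_le_left _ _).trans (hx₀ (by simpa using h))
    · rw [hout x h]; exact (min_le_right _ _).trans h
  -- Smoothing only `W - id`, with an approximant that vanishes wherever `W - id` does, keeps the
  -- new map `w` equal to the identity outside the ball; an error of `η / 2` keeps it away from
  -- zero.
  obtain ⟨g₁, hg₁, happ, hsupp⟩ := (hW.sub continuous_id).exists_contDiff_approx 1
    (ε := fun _ => η / 2) continuous_const (fun _ => half_pos hη0)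
  have hg₁0 : ∀ x, R ≤ ‖x‖ → g₁ x = 0 := by
    intro x hx
    by_contra h
    exact hsupp h (by simp [hout x hx])
  obtain ⟨C, hC⟩ := ContDiff.lipschitzWith_of_hasCompactSupport
    (HasCompactSupport.intro (isCompact_closedBall (0 : E) R) fun x hx =>
      hg₁0 x (by simpa using (not_le.1 (by simpa using hx)).le)) hg₁ (by simp)
  set w : E → E := fun x => x + g₁ x with hw
  have hwW : ∀ x, ‖w x - W x‖ ≤ η / 2 := by
    intro x
    have := (happ x).le
    rw [dist_eq_norm] at this
    rwa [show w x - W x = g₁ x - (W - id : E → E) x by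
      simp only [hw, Pi.sub_apply, id]; abel]
  have hwη : ∀ x, η / 2 ≤ ‖w x‖ := by
    intro x
    have h1 := norm_sub_norm_le (W x) (w x)
    rw [norm_sub_rev] at h1
    linarith [hWη x, hwW x]
  -- The enlargement absorbs the approximation error, so that `w` maps the larger ball into itself.
  set R' := R + η / 2 with hR'def
  have hwl : LipschitzWith (1 + C) w := LipschitzWith.id.add hC
  have hwin : ∀ x, ‖x‖ < R' → ‖w x‖ ≤ R' := by
    intro x hx
    rcases le_total ‖x‖ R with h | h
    · have h1 := norm_sub_norm_le (w x) (W x)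
      linarith [hin x h, hwW x]
    · simpa [hw, hg₁0 x h] using hx.le
  -- Adding `q` turns `w` into `R' w / ‖w‖` on the ball of radius `R'`: a Lipschitz retraction onto
  -- the sphere, which cannot exist.
  set q : E → E := fun x => max (R' - ‖w x‖) 0 • (‖w x‖⁻¹ • w x)
  have hR' : 0 < R' := by positivity
  have hql : LipschitzWith ((1 + R' * (2 / (η / 2))).toNNReal * (1 + C)) q := by
    refine LipschitzWith.of_dist_le_mul fun x y => ?_
    rw [dist_eq_norm]
    refine (norm_radial_sub_le (half_pos hη0) hR'.le (hwη x) (hwη y)).trans ?_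
    rw [NNReal.coe_mul, Real.coe_toNNReal _ (by positivity), mul_assoc, ← dist_eq_norm]
    gcongr
    exact hwl.dist_le_mul x y
  obtain ⟨x, hx, hxR⟩ := exists_norm_add_ne_of_lipschitzWith (hC.add hql) hR' (by
    intro x hx
    have h0 : g₁ x = 0 := hg₁0 x (by linarith)
    simp [q, hw, h0, hx])
  apply hxR
  have h0 : 0 < ‖w x‖ := (half_pos hη0).trans_le (hwη x)
  have : x + (g₁ x + q x) = R' • (‖w x‖⁻¹ • w x) := by
    have h1 : w x = ‖w x‖ • (‖w x‖⁻¹ • w x) := (smul_inv_smul₀ h0.ne' _).symm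
    rw [← add_assoc]
    change w x + q x = _
    simp only [q]
    rw [max_eq_left (by linarith [hwin x hx])]
    nth_rw 1 [h1]
    rw [← add_smul]
    congr 1; ring
  change ‖x + (g₁ x + q x)‖ = R'
  rw [this, norm_smul, norm_smul, norm_inv, norm_norm, inv_mul_cancel₀ h0.ne', mul_one,
    Real.norm_eq_abs, abs_of_pos hR']

/-- **Brouwer's fixed point theorem** for a ball. -/
theorem exists_fixedPoint_of_mapsTo_closedBall {F : E → E} {ρ : ℝ} (hρ : 0 < ρ)
    (hF : ContinuousOn F (Metric.closedBall 0 ρ))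
    (hmaps : MapsTo F (Metric.closedBall 0 ρ) (Metric.closedBall 0 ρ)) :
    ∃ x ∈ Metric.closedBall (0 : E) ρ, F x = x := by
  let proj : E → E := fun x => (ρ / max ρ ‖x‖) • x
  have hm : ∀ x : E, 0 < max ρ ‖x‖ := fun x => hρ.trans_le (le_max_left _ _)
  have hproj : ∀ x, proj x ∈ Metric.closedBall (0 : E) ρ := by
    intro x
    rw [mem_closedBall_zero_iff, norm_smul, Real.norm_eq_abs, abs_of_pos (div_pos hρ (hm x)),
      div_mul_eq_mul_div, div_le_iff₀ (hm x)]
    gcongr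
    exact le_max_right _ _
  have hprojc : Continuous proj :=
    (continuous_const.div (by fun_prop) fun x => (hm x).ne').smul continuous_id
  let χ : E → ℝ := fun x => max 0 (min 1 (2 - ‖x‖ / ρ))
  have hχc : Continuous χ := by fun_prop
  have hχ0 : ∀ x, 0 ≤ χ x := fun x => le_max_left _ _
  have hFp : ∀ x, ‖F (proj x)‖ ≤ ρ := fun x => by simpa using hmaps (hproj x)
  have hFc : Continuous fun x => F (proj x) := hF.comp_continuous hprojc hproj
  have hχ1 : ∀ x, ‖x‖ ≤ ρ → χ x = 1 := by
    intro x hx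
    have : ‖x‖ / ρ ≤ 1 := (div_le_one hρ).2 hx
    simp only [χ]
    rw [min_eq_left (by linarith), max_eq_right zero_le_one]
  have hχ2 : ∀ x, ρ ≤ ‖x‖ → ‖x‖ ≤ 2 * ρ → χ x = 2 - ‖x‖ / ρ := by
    intro x hx hx'
    have h1 : 1 ≤ ‖x‖ / ρ := (one_le_div hρ).2 hx
    have h2 : ‖x‖ / ρ ≤ 2 := (div_le_iff₀ hρ).2 hx'
    simp only [χ]
    rw [min_eq_right (by linarith), max_eq_right (by linarith)]
  have hχ3 : ∀ x, 2 * ρ ≤ ‖x‖ → χ x = 0 := by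
    intro x hx
    have h2 : 2 ≤ ‖x‖ / ρ := (le_div_iff₀ hρ).2 hx
    exact max_eq_left ((min_le_right _ _).trans (by linarith))
  -- The cutoff `χ` falls linearly from `1` at radius `ρ` to `0` at `2 * ρ`, exactly fast enough for
  -- `‖x‖ + χ x * ρ ≤ 2 * ρ`. A zero satisfies `x = χ x • F (proj x)`, hence lies in the small ball,
  -- where `χ = 1` and `proj x = x`.
  obtain ⟨x, hx⟩ := exists_eq_zero_of_eq_self_outside (W := fun x => x - χ x • F (proj x))
    (R := 2 * ρ) (continuous_id.sub (hχc.smul hFc)) (by positivity) (fun x hx => by simp [hχ3 x hx]) (by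
      intro x hx
      refine (norm_sub_le _ _).trans ?_
      rw [norm_smul, Real.norm_eq_abs, abs_of_nonneg (hχ0 x)]
      rcases le_total ‖x‖ ρ with h | h
      · rw [hχ1 x h]; linarith [hFp x]
      · calc ‖x‖ + χ x * ‖F (proj x)‖ ≤ ‖x‖ + χ x * ρ := by
              gcongr
              exact hFp x
          _ = 2 * ρ := by rw [hχ2 x h hx]; field_simp; ring)
  rw [sub_eq_zero] at hx
  have hxρ : ‖x‖ ≤ ρ := by
    rw [hx, norm_smul, Real.norm_eq_abs, abs_of_nonneg (hχ0 x)]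
    calc χ x * ‖F (proj x)‖ ≤ 1 * ρ := by
          gcongr
          exacts [max_le zero_le_one (min_le_left _ _), hFp x]
      _ = ρ := one_mul ρ
  refine ⟨x, by simpa using hxρ, ?_⟩
  have hpx : proj x = x := by
    simp only [proj]
    rw [max_eq_left hxρ, div_self hρ.ne', one_smul]
  rw [hχ1 x hxρ, one_smul, hpx] at hx
  exact hx.symm

/-- A continuous injective map of a compact set has a continuous left inverse. -/
theorem exists_continuous_leftInverse {F : Type*} [NormedAddCommGroup F] [NormedSpace ℝ F]
    [FiniteDimensional ℝ F] {Z : Type*} [MetricSpace Z]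
    {f : F → Z} {B : Set F} (hB : IsCompact B) (hf : ContinuousOn f B)
    (hinj : InjOn f B) : ∃ g : Z → F, Continuous g ∧ ∀ x ∈ B, g (f x) = x := by
  have : CompactSpace B := isCompact_iff_compactSpace.1 hB
  have hemb : IsClosedEmbedding (B.domRestrict f) :=
    (continuousOn_iff_continuous_domRestrict.1 hf).isClosedEmbedding
      (injOn_iff_injective.1 hinj)
  -- Tietze extension of the inverse from the closed image.
  obtain ⟨g, hg⟩ := ContinuousMap.exists_extension' hemb
    (⟨Subtype.val, continuous_subtype_val⟩ : C(B, F))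
  exact ⟨g, g.continuous, fun x hx => congrFun hg ⟨x, hx⟩⟩

/-- **Invariance of domain**: an injective continuous map of a ball of a Euclidean space into the
same space maps the centre to an interior point of the image. -/
theorem image_closedBall_mem_nhds {f : E → E} {ρ : ℝ} (hρ : 0 < ρ)
    (hf : ContinuousOn f (Metric.closedBall 0 ρ)) (hinj : InjOn f (Metric.closedBall 0 ρ)) :
    f '' Metric.closedBall 0 ρ ∈ 𝓝 (f 0) := by
  set B := Metric.closedBall (0 : E) ρ
  have hB : IsCompact B := isCompact_closedBall 0 ρ
  have h0B : (0 : E) ∈ B := Metric.mem_closedBall_self hρ.le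
  obtain ⟨g, hg, hgf⟩ := exists_continuous_leftInverse hB hf hinj
  have hg0 : g (f 0) = 0 := hgf 0 h0B
  have hfB : IsCompact (f '' B) := hB.image_of_continuousOn hf
  -- a continuous approximation of the inverse has a zero
  have stab : ∀ g' : E → E, ContinuousOn g' (f '' B) → (∀ z ∈ f '' B, ‖g z - g' z‖ ≤ ρ) →
      ∃ z ∈ f '' B, g' z = 0 := by
    intro g' hg' hclose
    obtain ⟨x, hx, hxx⟩ := exists_fixedPoint_of_mapsTo_closedBall (F := fun x => x - g' (f x)) hρ
      (continuousOn_id.sub (hg'.comp hf (mapsTo_image f B))) (by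
        intro x hx
        have := hclose (f x) (mem_image_of_mem f hx)
        rwa [hgf x hx, ← mem_closedBall_zero_iff] at this)
    exact ⟨f x, mem_image_of_mem f hx, by simpa using hxx⟩
  -- If `f 0` is not interior, some `c` near it is missed by `f`. Pushing the part of the image near
  -- `c` onto a sphere about `c`, which is null, allows `g` to be replaced by a nearby map without
  -- zeros, contrary to `stab`.
  by_contra hnot
  obtain ⟨ε, hε, hgε⟩ : ∃ ε > 0, ∀ z, dist z (f 0) < 2 * ε → ‖g z‖ ≤ ρ / 4 := by
    obtain ⟨δ, hδ, h⟩ := Metric.continuousAt_iff.1 hg.continuousAt (ρ / 4) (by positivity)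
    refine ⟨δ / 2, half_pos hδ, fun z hz => ?_⟩
    have := h (x := z) (by linarith)
    rw [hg0, dist_zero_right] at this
    exact this.le
  obtain ⟨c, hcε, hcB⟩ : ∃ c, dist c (f 0) < ε ∧ c ∉ f '' B := by
    by_contra! h
    exact hnot (mem_of_superset (Metric.ball_mem_nhds _ hε) fun c hc => h c hc)
  have hgc : ∀ z, dist z c ≤ ε → ‖g z‖ ≤ ρ / 4 := fun z hz =>
    hgε z (by linarith [dist_triangle z c (f 0)])
  set S₁ := f '' B ∩ {z | ε ≤ dist z c}
  have hS₁ : IsCompact S₁ := hfB.inter_right (isClosed_le continuous_const (by fun_prop))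
  obtain ⟨δ, hδ, hδρ, hgS⟩ : ∃ δ > 0, δ ≤ ρ / 4 ∧ ∀ z ∈ S₁, δ ≤ ‖g z‖ := by
    have hne : ∀ z ∈ S₁, g z ≠ 0 := by
      rintro z ⟨⟨x, hx, rfl⟩, hz⟩ h
      rw [hgf x hx] at h
      subst h
      rw [mem_ofPred_eq, dist_comm] at hz
      linarith
    rcases S₁.eq_empty_or_nonempty with he | he
    · exact ⟨ρ / 4, by positivity, le_rfl, by simp [he]⟩
    · obtain ⟨z, hz, hmin⟩ := hS₁.exists_isMinOn he hg.norm.continuousOn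
      exact ⟨min ‖g z‖ (ρ / 4), lt_min (norm_pos_iff.2 (hne z hz)) (by positivity),
        min_le_right _ _, fun z' hz' => (min_le_left _ _).trans (hmin hz')⟩
  obtain ⟨p, hp, hpg, -⟩ := hg.exists_contDiff_approx 1 (ε := fun _ => δ / 2) continuous_const
    (fun _ => half_pos hδ)
  -- The `C¹` map `p` sends the sphere to a null set, so an arbitrarily small shift `v` removes the
  -- zeros of `p` there.
  obtain ⟨v, hvδ, hv⟩ : ∃ v, ‖v‖ < δ / 2 ∧ v ∉ p '' Metric.sphere c ε := by
    borelize E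
    let μ : Measure E := Measure.addHaar
    have hnull : μ (p '' Metric.sphere c ε) = 0 :=
      addHaar_image_eq_zero_of_differentiableOn_of_addHaar_eq_zero μ
        (hp.differentiable (by simp)).differentiableOn
        (Measure.addHaar_sphere_of_ne_zero μ c hε.ne')
    by_contra! h
    have hsub : Metric.ball (0 : E) (δ / 2) ⊆ p '' Metric.sphere c ε :=
      fun v hv => h v (by simpa using hv)
    exact (Metric.measure_ball_pos μ (0 : E) (half_pos hδ)).ne' (measure_mono_null hsub hnull)
  -- `Φ` moves the points within `ε` of `c` radially onto the sphere and fixes the others. It is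
  -- continuous on the image only because `c` is not in the image.
  let Φ : E → E := fun z => c + max (ε / dist z c) 1 • (z - c)
  have hzc : ∀ z ∈ f '' B, 0 < dist z c := fun z hz => dist_pos.2 fun h => hcB (h ▸ hz)
  have hΦ : ContinuousOn Φ (f '' B) := by
    refine continuousOn_const.add (ContinuousOn.smul ?_ (by fun_prop))
    refine ContinuousOn.sup (ContinuousOn.div continuousOn_const (by fun_prop) fun z hz => ?_)
      continuousOn_const
    exact (hzc z hz).ne'
  have hΦ₁ : ∀ z ∈ f '' B, ε ≤ dist z c → Φ z = z := by
    intro z hz h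
    have : ε / dist z c ≤ 1 := (div_le_one (hzc z hz)).2 h
    simp [Φ, max_eq_right this]
  have hΦ₂ : ∀ z ∈ f '' B, dist z c ≤ ε → Φ z ∈ Metric.sphere c ε := by
    intro z hz h
    have : 1 ≤ ε / dist z c := (one_le_div (hzc z hz)).2 h
    rw [mem_sphere_iff_norm]
    simp only [Φ, max_eq_left this, add_sub_cancel_left]
    rw [norm_smul, ← dist_eq_norm, Real.norm_eq_abs, abs_of_pos (div_pos hε (hzc z hz)),
      div_mul_cancel₀ _ (hzc z hz).ne']
  have hpg' : ∀ z, ‖p z - g z‖ ≤ δ / 2 := fun z => by rw [← dist_eq_norm]; exact (hpg z).le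
  obtain ⟨z, hz, hz0⟩ := stab (fun z => p (Φ z) - v)
    ((hp.continuous.comp_continuousOn hΦ).sub continuousOn_const) (by
      intro z hz
      rcases le_total ε (dist z c) with h | h
      · rw [hΦ₁ z hz h, show g z - (p z - v) = v - (p z - g z) by abel]
        linarith [norm_sub_le v (p z - g z), hpg' z]
      · have h2 := hgc z h
        have h3 := hgc (Φ z) (Metric.mem_sphere.1 (hΦ₂ z hz h)).le
        rw [show g z - (p (Φ z) - v) = g z - g (Φ z) + (v - (p (Φ z) - g (Φ z))) by abel]
        linarith [norm_add_le (g z - g (Φ z)) (v - (p (Φ z) - g (Φ z))),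
          norm_sub_le v (p (Φ z) - g (Φ z)), hpg' (Φ z), norm_sub_le (g z) (g (Φ z))])
  rw [sub_eq_zero] at hz0
  rcases le_total ε (dist z c) with h | h
  · rw [hΦ₁ z hz h] at hz0
    have h1 := hgS z ⟨hz, h⟩
    have h2 := norm_sub_norm_le (g z) (p z)
    rw [norm_sub_rev] at h2
    rw [hz0] at h2
    have := hpg' z
    rw [hz0] at this
    linarith
  · exact hv ⟨Φ z, hΦ₂ z hz h, hz0⟩

/-- A map that is uniformly close to a continuous injective one between spaces of the same
dimension has a zero near a zero of the latter. -/
theorem exists_zero_of_near_injOn {Y : Type*} [NormedAddCommGroup Y] [NormedSpace ℝ Y]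
    (e : Y ≃L[ℝ] E) {G : Y → E} {y₀ : Y} {K : Set Y} (hK : K ∈ 𝓝 y₀) (hG : ContinuousOn G K)
    (hinj : InjOn G K) (hG0 : G y₀ = 0) :
    ∃ ε > 0, ∀ H : Y → E, ContinuousOn H K → (∀ y ∈ K, ‖H y - G y‖ ≤ ε) → ∃ y ∈ K, H y = 0 := by
  let i : E → Y := fun z => y₀ + e.symm z
  have hic : Continuous i := by fun_prop
  have hi : Function.Injective i := fun a b h => e.symm.injective (add_left_cancel h)
  have hi0 : i 0 = y₀ := by simp [i]
  have hKi : i ⁻¹' K ∈ 𝓝 (0 : E) := hic.continuousAt (by rwa [hi0])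
  obtain ⟨ρ, hρ, hρK⟩ := Metric.nhds_basis_closedBall.mem_iff.1 hKi
  set B := Metric.closedBall (0 : E) ρ
  have hmaps : MapsTo i B K := hρK
  have hf : ContinuousOn (G ∘ i) B := hG.comp hic.continuousOn hmaps
  have hfinj : InjOn (G ∘ i) B := hinj.comp hi.injOn hmaps
  have hB : IsCompact B := isCompact_closedBall _ _
  have hnhds := image_closedBall_mem_nhds hρ hf hfinj
  rw [Function.comp_apply, hi0, hG0] at hnhds
  obtain ⟨ε, hε, hεB⟩ := Metric.nhds_basis_closedBall.mem_iff.1 hnhds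
  obtain ⟨g, hg, hgf⟩ := exists_continuous_leftInverse hB hf hfinj
  have hgz : ∀ z ∈ Metric.closedBall (0 : E) ε, g z ∈ B ∧ G (i (g z)) = z := by
    intro z hz
    obtain ⟨x, hx, rfl⟩ := hεB hz
    rw [hgf x hx]
    exact ⟨hx, rfl⟩
  refine ⟨ε, hε, fun H hH hclose => ?_⟩
  -- Since `G (i (g z)) = z` on the ball, this map is the difference `G - H` at the point `i (g z)`,
  -- of norm at most `ε`; a fixed point is a zero of `H`.
  obtain ⟨z, hz, hzz⟩ := exists_fixedPoint_of_mapsTo_closedBall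
    (F := fun z => z - H (i (g z))) hε
    (continuousOn_id.sub (hH.comp (hic.comp hg).continuousOn fun z hz => hmaps (hgz z hz).1)) (by
      intro z hz
      have := hclose (i (g z)) (hmaps (hgz z hz).1)
      rw [(hgz z hz).2, norm_sub_rev] at this
      simpa using this)
  exact ⟨i (g z), hmaps (hgz z hz).1, by simpa using hzz⟩

end FixedPoint

/-! ### Bounded Lipschitz differential equations, truncation, and uniform constants. -/

section Flow

variable {E : Type*} [NormedAddCommGroup E] [NormedSpace ℝ E]

/-- `u` solves `u' = v(t, u)` on `[A, B]`, with one-sided derivatives at the end points. -/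
def IsSolutionOn (v : ℝ → E → E) (A B : ℝ) (u : ℝ → E) : Prop :=
  ∀ t ∈ Icc A B, HasDerivWithinAt u (v t (u t)) (Icc A B) t

namespace IsSolutionOn

variable {v : ℝ → E → E} {A B : ℝ} {u u₁ u₂ : ℝ → E} {K : NNReal} {M : ℝ}

theorem continuousOn (hu : IsSolutionOn v A B u) : ContinuousOn u (Icc A B) :=
  fun t ht => (hu t ht).continuousWithinAt

theorem mono (hu : IsSolutionOn v A B u) {A' B' : ℝ} (hA : A ≤ A') (hB : B' ≤ B) :
    IsSolutionOn v A' B' u := fun t ht =>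
  (hu t ⟨hA.trans ht.1, ht.2.trans hB⟩).mono (Icc_subset_Icc hA hB)

theorem hasDerivWithinAt_Ici (hu : IsSolutionOn v A B u) {t : ℝ} (ht : t ∈ Ico A B) :
    HasDerivWithinAt u (v t (u t)) (Ici t) t :=
  (hu t (Ico_subset_Icc_self ht)).mono_of_mem_nhdsWithin
    (mem_of_superset (Icc_mem_nhdsGE ht.2) (Icc_subset_Icc_left ht.1))

theorem comp_neg (hu : IsSolutionOn v A B u) :
    IsSolutionOn (fun t x => -v (-t) x) (-B) (-A) (fun t => u (-t)) := by
  intro t ht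
  have ht' : -t ∈ Icc A B := ⟨by linarith [ht.2], by linarith [ht.1]⟩
  have := (hu (-t) ht').scomp t (hasDerivWithinAt_id t (Icc (-B) (-A))).neg
    (fun s hs => ⟨by linarith [hs.2], by linarith [hs.1]⟩)
  simpa using! this

/-- Grönwall's inequality forward in time; backward in time it is applied to the reversed equation
of `comp_neg`. -/
theorem dist_le (hv : ∀ t, LipschitzWith K (v t)) (hu₁ : IsSolutionOn v A B u₁)
    (hu₂ : IsSolutionOn v A B u₂) {s t : ℝ} (hs : s ∈ Icc A B) (ht : t ∈ Icc A B) :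
    dist (u₁ t) (u₂ t) ≤ Real.exp (K * (B - A)) * dist (u₁ s) (u₂ s) := by
  have fwd : ∀ {v : ℝ → E → E} {A B : ℝ} {u₁ u₂ : ℝ → E} (_ : ∀ t, LipschitzWith K (v t))
      (_ : IsSolutionOn v A B u₁) (_ : IsSolutionOn v A B u₂) {s t : ℝ} (_ : A ≤ s) (_ : s ≤ t)
      (_ : t ≤ B), dist (u₁ t) (u₂ t) ≤ Real.exp (K * (B - A)) * dist (u₁ s) (u₂ s) := by
    intro v A B u₁ u₂ hv hu₁ hu₂ s t hs hst ht
    have h₁ := hu₁.mono hs le_rfl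
    have h₂ := hu₂.mono hs le_rfl
    have := dist_le_of_trajectories_ODE hv h₁.continuousOn
      (fun t ht => h₁.hasDerivWithinAt_Ici ht) h₂.continuousOn
      (fun t ht => h₂.hasDerivWithinAt_Ici ht) le_rfl t ⟨hst, ht⟩
    rw [mul_comm]
    refine this.trans ?_
    gcongr
  rcases le_total s t with h | h
  · exact fwd hv hu₁ hu₂ hs.1 h ht.2
  · have := fwd (fun t => (hv (-t)).neg) hu₁.comp_neg hu₂.comp_neg (s := -s) (t := -t)
      (by linarith [hs.2]) (by linarith) (by linarith [ht.1])
    rw [neg_neg, neg_neg, show -A - -B = B - A by ring] at this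
    exact this

theorem dist_apply_le (hu : IsSolutionOn v A B u) (hM : ∀ t x, ‖v t x‖ ≤ M) {s t : ℝ}
    (hs : s ∈ Icc A B) (ht : t ∈ Icc A B) : dist (u t) (u s) ≤ M * |t - s| := by
  rw [dist_eq_norm]
  exact (convex_Icc A B).norm_image_sub_le_of_norm_hasDerivWithin_le hu
    (fun x _ => hM x _) hs ht

/-- Lipschitz dependence of a solution on initial time, initial value and time. -/
theorem dist_flow_le (hv : ∀ t, LipschitzWith K (v t)) (hM : ∀ t x, ‖v t x‖ ≤ M)
    (hu₁ : IsSolutionOn v A B u₁) (hu₂ : IsSolutionOn v A B u₂) {s₁ s₂ t₁ t₂ : ℝ}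
    (hs₁ : s₁ ∈ Icc A B) (hs₂ : s₂ ∈ Icc A B) (ht₁ : t₁ ∈ Icc A B) (ht₂ : t₂ ∈ Icc A B) :
    dist (u₁ t₁) (u₂ t₂) ≤ Real.exp (K * (B - A)) * (dist (u₁ s₁) (u₂ s₂) + M * |s₁ - s₂|)
      + M * |t₁ - t₂| := by
  calc dist (u₁ t₁) (u₂ t₂) ≤ dist (u₁ t₁) (u₂ t₁) + dist (u₂ t₁) (u₂ t₂) := dist_triangle _ _ _
    _ ≤ Real.exp (K * (B - A)) * dist (u₁ s₁) (u₂ s₁) + M * |t₁ - t₂| :=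
        add_le_add (dist_le hv hu₁ hu₂ hs₁ ht₁) (hu₂.dist_apply_le hM ht₂ ht₁)
    _ ≤ _ := by
        gcongr
        refine (dist_triangle _ (u₂ s₂) _).trans ?_
        gcongr
        rw [abs_sub_comm]
        exact hu₂.dist_apply_le hM hs₁ hs₂

end IsSolutionOn

/-- The bound `M` holds everywhere, so the Picard–Lindelöf ball can be taken as large as the
interval requires and the solution reaches both end points. -/
theorem exists_isSolutionOn [CompleteSpace E] {v : ℝ → E → E} {K : NNReal} {M A B : ℝ}
    (hv : ∀ t, LipschitzWith K (v t)) (hc : ∀ x, Continuous fun t => v t x)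
    (hM : ∀ t x, ‖v t x‖ ≤ M) {s : ℝ} (hs : s ∈ Icc A B) (x : E) :
    ∃ u, u s = x ∧ IsSolutionOn v A B u := by
  have hM0 : 0 ≤ M := (norm_nonneg _).trans (hM 0 x)
  have hPL : IsPicardLindelof v (⟨s, hs⟩ : Icc A B) x
      (M.toNNReal * (max (B - s) (s - A)).toNNReal) 0 M.toNNReal K := by
    refine ⟨fun t _ => (hv t).lipschitzOnWith, fun y _ => (hc y).continuousOn, fun t _ y _ => ?_, ?_⟩
    · rw [Real.coe_toNNReal _ hM0]
      exact hM t y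
    · have : 0 ≤ max (B - s) (s - A) := le_max_of_le_left (by linarith [hs.2])
      simp [Real.coe_toNNReal _ this]
  obtain ⟨u, hu, hu'⟩ := hPL.exists_eq_forall_mem_Icc_hasDerivWithinAt (x := x) (by simp)
  exact ⟨u, hu, hu'⟩

/-- Radial truncation to the closed ball of radius `σ`. -/
noncomputable def truncate (σ : ℝ) (z : E) : E := (σ / max σ ‖z‖) • z

theorem norm_truncate_le {σ : ℝ} (hσ : 0 < σ) (z : E) : ‖truncate σ z‖ ≤ σ := by
  have hm : 0 < max σ ‖z‖ := hσ.trans_le (le_max_left _ _)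
  rw [truncate, norm_smul, Real.norm_eq_abs, abs_of_pos (div_pos hσ hm),
    div_mul_eq_mul_div, div_le_iff₀ hm]
  gcongr
  exact le_max_right _ _

theorem truncate_of_norm_le {σ : ℝ} (hσ : 0 < σ) {z : E} (hz : ‖z‖ ≤ σ) : truncate σ z = z := by
  rw [truncate, max_eq_left hz, div_self hσ.ne', one_smul]

theorem lipschitzWith_truncate {σ : ℝ} (hσ : 0 < σ) : LipschitzWith 2 (truncate σ : E → E) := by
  refine LipschitzWith.of_dist_le_mul fun z z' => ?_
  rw [dist_eq_norm, dist_eq_norm]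
  have hm : 0 < max σ ‖z‖ := hσ.trans_le (le_max_left _ _)
  have hm' : 0 < max σ ‖z'‖ := hσ.trans_le (le_max_left _ _)
  have h : truncate σ z - truncate σ z' = (σ / max σ ‖z‖) • (z - z')
      + (σ / max σ ‖z‖ - σ / max σ ‖z'‖) • z' := by
    rw [truncate, truncate, smul_sub, sub_smul]; abel
  have h1 : ‖(σ / max σ ‖z‖) • (z - z')‖ ≤ ‖z - z'‖ := by
    rw [norm_smul, Real.norm_eq_abs, abs_of_pos (div_pos hσ hm)]
    exact mul_le_of_le_one_left (norm_nonneg _) ((div_le_one hm).2 (le_max_left _ _))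
  have h2 : ‖(σ / max σ ‖z‖ - σ / max σ ‖z'‖) • z'‖ ≤ ‖z - z'‖ := by
    have e : σ / max σ ‖z‖ - σ / max σ ‖z'‖
        = (σ / max σ ‖z‖) * ((max σ ‖z'‖ - max σ ‖z‖) / max σ ‖z'‖) := by
      field_simp
    rw [e, norm_smul, norm_mul, Real.norm_eq_abs, abs_of_pos (div_pos hσ hm), norm_div,
      Real.norm_eq_abs (max σ ‖z'‖), abs_of_pos hm', mul_assoc, div_mul_eq_mul_div (‖_‖)]
    have h3 : ‖max σ ‖z'‖ - max σ ‖z‖‖ ≤ ‖z - z'‖ := by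
      rw [Real.norm_eq_abs, max_comm σ, max_comm σ, norm_sub_rev]
      exact (abs_max_sub_max_le_abs _ _ _).trans (abs_norm_sub_norm_le _ _)
    have h4 : ‖max σ ‖z'‖ - max σ ‖z‖‖ * ‖z'‖ / max σ ‖z'‖ ≤ ‖z - z'‖ := by
      rw [div_le_iff₀ hm']
      gcongr
      exact le_max_right _ _
    refine (mul_le_of_le_one_left (by positivity) ((div_le_one hm).2 (le_max_left _ _))).trans h4
  rw [h]
  calc _ ≤ _ := norm_add_le _ _
    _ ≤ ‖z - z'‖ + ‖z - z'‖ := add_le_add h1 h2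
    _ = _ := by rw [NNReal.coe_ofNat]; ring

theorem LipschitzOnWith.clm_apply_of_bounded {X F : Type*} [PseudoMetricSpace X]
    [NormedAddCommGroup F] [NormedSpace ℝ F] {S : X → E →L[ℝ] F} {b : X → E} {s : Set X}
    {KS Kb : NNReal} {MS Mb : NNReal} (hS : LipschitzOnWith KS S s) (hb : LipschitzOnWith Kb b s)
    (hMS : ∀ x ∈ s, ‖S x‖ ≤ MS) (hMb : ∀ x ∈ s, ‖b x‖ ≤ Mb) :
    LipschitzOnWith (MS * Kb + KS * Mb) (fun x => S x (b x)) s := by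
  refine LipschitzOnWith.of_dist_le_mul fun x hx y hy => ?_
  rw [dist_eq_norm]
  have : S x (b x) - S y (b y) = S x (b x - b y) + (S x - S y) (b y) := by
    simp
  rw [this]
  have h1 := hS.dist_le_mul x hx y hy
  have h2 := hb.dist_le_mul x hx y hy
  rw [dist_eq_norm] at h1 h2
  calc _ ≤ ‖S x (b x - b y)‖ + ‖(S x - S y) (b y)‖ := norm_add_le _ _
    _ ≤ MS * (Kb * dist x y) + KS * dist x y * Mb := by
        gcongr
        · exact (ContinuousLinearMap.le_opNorm _ _).trans (by gcongr; exact hMS x hx)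
        · exact (ContinuousLinearMap.le_opNorm _ _).trans (by gcongr; exact hMb y hy)
    _ = _ := by push_cast; ring

theorem LipschitzOnWith.exists_norm_le_of_isBounded {X Z : Type*} [PseudoMetricSpace X]
    [NormedAddCommGroup Z] {b : X → Z}
    {s : Set X} {K : NNReal} (hb : LipschitzOnWith K b s) (hs : Bornology.IsBounded s) :
    ∃ M : NNReal, ∀ x ∈ s, ‖b x‖ ≤ M := by
  rcases s.eq_empty_or_nonempty with rfl | ⟨x₀, hx₀⟩
  · exact ⟨0, by simp⟩
  refine ⟨(‖b x₀‖ + K * Metric.diam s).toNNReal, fun x hx => ?_⟩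
  rw [Real.coe_toNNReal _ (by positivity)]
  have h1 := hb.dist_le_mul x hx x₀ hx₀
  have h2 : dist x x₀ ≤ Metric.diam s := Metric.dist_le_diam_of_mem hs hx hx₀
  rw [dist_eq_norm] at h1
  have h3 : (K : ℝ) * dist x x₀ ≤ K * Metric.diam s := by gcongr
  linarith [norm_sub_norm_le (b x) (b x₀)]

/-- A Lebesgue number argument: halving the local radii leaves room for balls about neighbouring
points. It provides one tube and one Lipschitz constant along a whole branch. -/
theorem IsCompact.exists_uniform_ball {X : Type*} [PseudoMetricSpace X] {k : Set X}
    (hk : IsCompact k) {Q : NNReal → Set X → Prop}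
    (hQ : ∀ ⦃L L' s s'⦄, L ≤ L' → s' ⊆ s → Q L s → Q L' s')
    (h : ∀ x ∈ k, ∃ r > 0, ∃ L, Q L (Metric.ball x r)) :
    ∃ r > 0, ∃ L, ∀ x ∈ k, Q L (Metric.ball x r) := by
  refine hk.induction_on (p := fun S => ∃ r > 0, ∃ L, ∀ x ∈ S, Q L (Metric.ball x r))
    ⟨1, one_pos, 0, by simp⟩ ?_ ?_ ?_
  · rintro s t hst ⟨r, hr, L, hL⟩
    exact ⟨r, hr, L, fun x hx => hL x (hst hx)⟩
  · rintro s t ⟨r, hr, L, hL⟩ ⟨r', hr', L', hL'⟩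
    refine ⟨min r r', lt_min hr hr', max L L', ?_⟩
    rintro x (hx | hx)
    · exact hQ (le_max_left _ _) (Metric.ball_subset_ball (min_le_left _ _)) (hL x hx)
    · exact hQ (le_max_right _ _) (Metric.ball_subset_ball (min_le_right _ _)) (hL' x hx)
  · intro x hx
    obtain ⟨r, hr, L, hL⟩ := h x hx
    refine ⟨Metric.ball x (r / 2), mem_nhdsWithin_of_mem_nhds (Metric.ball_mem_nhds x (half_pos hr)),
      r / 2, half_pos hr, L, fun y hy => hQ le_rfl (Metric.ball_subset_ball' ?_) hL⟩
    rw [Metric.mem_ball] at hy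
    linarith

end Flow

/-! ### The velocity field `(f')⁻¹ a` and its global extension. -/

theorem isUnit_fderiv_of_openPartialHomeomorph {n : ℕ} {g : Vec n → Vec n}
    (φ : OpenPartialHomeomorph (Vec n) (Vec n)) (hg : EqOn g φ φ.source)
    (hd : DifferentiableOn ℝ g φ.source) (hd' : DifferentiableOn ℝ φ.symm φ.target)
    {U : Vec n} (hU : U ∈ φ.source) : IsUnit (fderiv ℝ g U) := by
  have hgU : HasFDerivAt g (fderiv ℝ g U) U :=
    ((hd U hU).differentiableAt (φ.open_source.mem_nhds hU)).hasFDerivAt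
  have hφU : HasFDerivAt φ (fderiv ℝ g U) U :=
    hgU.congr_of_eventuallyEq (hg.symm.eventuallyEq_of_mem (φ.open_source.mem_nhds hU))
  have ht : φ U ∈ φ.target := φ.map_source hU
  have hs : HasFDerivAt φ.symm (fderiv ℝ φ.symm (φ U)) (φ U) :=
    ((hd' _ ht).differentiableAt (φ.open_target.mem_nhds ht)).hasFDerivAt
  -- The chain rule in both orders of composition makes the derivative of the inverse a two-sided
  -- inverse.
  have h1 : fderiv ℝ φ.symm (φ U) * fderiv ℝ g U = 1 :=
    (hs.comp U hφU).unique ((hasFDerivAt_id U).congr_of_eventuallyEq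
      (φ.eventually_left_inverse hU))
  have h2 : fderiv ℝ g U * fderiv ℝ φ.symm (φ U) = 1 := by
    rw [← φ.left_inv hU] at hφU
    have h := hφU.comp (φ U) hs
    rw [φ.left_inv hU] at h
    exact h.unique ((hasFDerivAt_id _).congr_of_eventuallyEq (φ.eventually_right_inverse ht))
  exact ⟨⟨_, _, h2, h1⟩, rfl⟩

/-- The velocity field `(f')⁻¹ a` of the equation `f(U)_x = a(U,x)` is locally Lipschitz. -/
theorem exists_ball_lipschitzOnWith_velocity {n : ℕ} {f : Vec n → Vec n} {D : Set (Vec n)}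
    (hD : IsOpen D) {a : Vec n → ℝ → Vec n} {U : Vec n} {x : ℝ} (hUD : U ∈ D)
    (hf : IsC11DiffeoNear f U) {T : Set (Vec n × ℝ)}
    (ha : ∃ s ∈ 𝓝[T] (U, x), ∃ K, LipschitzOnWith K (Function.uncurry a) s) :
    ∃ r > 0, ∃ L : NNReal,
      LipschitzOnWith L (fun z : Vec n × ℝ => Ring.inverse (fderiv ℝ f z.1) (a z.1 z.2))
        (Metric.ball (U, x) r ∩ T) ∧
      ∀ z ∈ Metric.ball (U, x) r, z.1 ∈ D ∧ IsUnit (fderiv ℝ f z.1) := by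
  obtain ⟨φ, hUφ, hfφ, ⟨hfd, Kf, hKf⟩, hφd, -⟩ := hf
  obtain ⟨s, hs, Ka, hKa⟩ := ha
  have hunit : ∀ V ∈ φ.source, IsUnit (fderiv ℝ f V) := fun V hV =>
    isUnit_fderiv_of_openPartialHomeomorph φ hfφ hfd hφd hV
  obtain ⟨A, hA⟩ := hunit U hUφ
  -- Inversion of operators is `C¹` near an invertible one; composed with the Lipschitz derivative
  -- of the flux it stays Lipschitz.
  obtain ⟨Ki, t, ht, hKi⟩ := (contDiffAt_ringInverse ℝ A (n := 1)).exists_lipschitzOnWith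
  rw [hA] at ht
  have hcont : ContinuousAt (fderiv ℝ f) U :=
    (hKf.continuousOn U hUφ).continuousAt (φ.open_source.mem_nhds hUφ)
  have hmem : φ.source ∩ D ∩ fderiv ℝ f ⁻¹' t ∈ 𝓝 U :=
    inter_mem (inter_mem (φ.open_source.mem_nhds hUφ) (hD.mem_nhds hUD)) (hcont ht)
  obtain ⟨r₁, hr₁, hball⟩ := Metric.mem_nhds_iff.1 hmem
  obtain ⟨r₂, hr₂, hballs⟩ := Metric.mem_nhdsWithin_iff.1 hs
  have hfst : ∀ {r} {z : Vec n × ℝ}, z ∈ Metric.ball (U, x) r → z.1 ∈ Metric.ball U r :=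
    fun {r z} hz => (le_max_left (dist z.1 U) (dist z.2 x)).trans_lt hz
  have hr : 0 < min r₁ r₂ := lt_min hr₁ hr₂
  have hin : ∀ z ∈ Metric.ball (U, x) (min r₁ r₂), z.1 ∈ φ.source ∩ D ∩ fderiv ℝ f ⁻¹' t :=
    fun z hz => hball (Metric.ball_subset_ball (min_le_left _ _) (hfst hz))
  refine ⟨min r₁ r₂, hr, ?_⟩
  set b := Metric.ball (U, x) (min r₁ r₂) ∩ T
  have hb : Bornology.IsBounded b := Metric.isBounded_ball.subset inter_subset_left
  have hS : LipschitzOnWith (Ki * (Kf * 1))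
      (fun z : Vec n × ℝ => Ring.inverse (fderiv ℝ f z.1)) b := by
    refine LipschitzOnWith.comp (g := Ring.inverse) hKi ?_ fun z hz => (hin z hz.1).2
    exact hKf.comp LipschitzWith.prod_fst.lipschitzOnWith fun z hz => (hin z hz.1).1.1
  have hab : LipschitzOnWith Ka (fun z : Vec n × ℝ => a z.1 z.2) b := by
    refine hKa.mono fun z hz => hballs ⟨Metric.ball_subset_ball (min_le_right _ _) hz.1, hz.2⟩
  obtain ⟨MS, hMS⟩ := hS.exists_norm_le_of_isBounded hb
  obtain ⟨Ma, hMa⟩ := hab.exists_norm_le_of_isBounded hb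
  exact ⟨_, hS.clm_apply_of_bounded hab hMS hMa,
    fun z hz => ⟨(hin z hz).1.2, hunit _ (hin z hz).1.1⟩⟩

namespace SteadyProblem

variable {n I : ℕ} (P : SteadyProblem n I)

/-- Near a branch the equation agrees with `U' = v(x, U)` for a bounded, globally Lipschitz `v`. -/
theorem exists_global_velocity {p q : ℝ} (hpq : p ≤ q) (hp : P.xL ≤ p) (hq : q ≤ P.xR)
    {c : ℝ → Vec n} (hc : ContinuousOn c (Icc p q)) (hcD : ∀ x ∈ Icc p q, c x ∈ P.D)
    (hf : ∀ x ∈ Icc p q, IsC11DiffeoNear P.f (c x))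
    (ha : ∀ x ∈ Icc p q, ∃ s ∈ 𝓝[univ ×ˢ Icc P.xL P.xR] (c x, x), ∃ K,
      LipschitzOnWith K (Function.uncurry P.a) s) :
    ∃ (σ : ℝ) (L : NNReal) (M : ℝ) (v : ℝ → Vec n → Vec n), 0 < σ ∧ 0 ≤ M ∧
      (∀ t, LipschitzWith L (v t)) ∧ (∀ U, Continuous fun t => v t U) ∧ (∀ t U, ‖v t U‖ ≤ M) ∧
      ∀ t ∈ Icc (max P.xL (p - σ)) (min P.xR (q + σ)), ∀ U,
        dist U (c (projIcc p q hpq t)) ≤ σ →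
          U ∈ P.D ∧ IsUnit (fderiv ℝ P.f U) ∧ fderiv ℝ P.f U (v t U) = P.a U t := by
  set T : Set (Vec n × ℝ) := univ ×ˢ Icc P.xL P.xR
  let w : Vec n × ℝ → Vec n := fun z => Ring.inverse (fderiv ℝ P.f z.1) (P.a z.1 z.2)
  have hK : IsCompact ((fun x => (c x, x)) '' Icc p q) :=
    isCompact_Icc.image_of_continuousOn (hc.prodMk continuousOn_id)
  obtain ⟨ρ, hρ, L, hL⟩ := hK.exists_uniform_ball
    (Q := fun L s => LipschitzOnWith L w (s ∩ T) ∧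
      ∀ z ∈ s, z.1 ∈ P.D ∧ IsUnit (fderiv ℝ P.f z.1))
    (fun L L' s s' hLL hss h => ⟨(h.1.mono (inter_subset_inter_left _ hss)).weaken hLL,
      fun z hz => h.2 z (hss hz)⟩)
    (by
      rintro _ ⟨x, hx, rfl⟩
      exact exists_ball_lipschitzOnWith_velocity P.isOpen_D (hcD x hx) (hf x hx) (ha x hx))
  set σ := ρ / 2
  have hσ : 0 < σ := half_pos hρ
  set A := max P.xL (p - σ)
  set B := min P.xR (q + σ)
  have hA : A ≤ p := max_le hp (by linarith)
  have hB : q ≤ B := le_min hq (by linarith)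
  have hAB : A ≤ B := hA.trans (hpq.trans hB)
  let cl : ℝ → ℝ := fun t => projIcc p q hpq t
  let r : ℝ → ℝ := fun t => projIcc A B hAB t
  have hclc : Continuous cl := continuous_subtype_val.comp continuous_projIcc
  have hrc : Continuous r := continuous_subtype_val.comp continuous_projIcc
  have hcl : ∀ t, cl t ∈ Icc p q := fun t => (projIcc p q hpq t).2
  have hr : ∀ t, r t ∈ Icc A B := fun t => (projIcc A B hAB t).2
  have hrt : ∀ t ∈ Icc A B, r t = t := fun t ht => by simp only [r]; rw [projIcc_of_mem hAB ht]
  have hABT : ∀ t ∈ Icc A B, t ∈ Icc P.xL P.xR := fun t ht =>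
    ⟨(le_max_left _ _).trans ht.1, ht.2.trans (min_le_left _ _)⟩
  have hclt : ∀ t ∈ Icc A B, |t - cl t| ≤ σ := by
    intro t ht
    have h1 : p - σ ≤ t := (le_max_right _ _).trans ht.1
    have h2 : t ≤ q + σ := ht.2.trans (min_le_right _ _)
    simp only [cl, projIcc, abs_le]
    rcases le_total t q with h | h
    · rw [min_eq_right h]
      rcases le_total p t with h' | h'
      · rw [max_eq_right h']; constructor <;> linarith
      · rw [max_eq_left h']; constructor <;> linarith
    · rw [min_eq_left h, max_eq_right hpq]; constructor <;> linarith
  have hball : ∀ t ∈ Icc A B, ∀ U, dist U (c (cl t)) ≤ σ →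
      (U, t) ∈ Metric.ball (c (cl t), cl t) ρ ∩ T := by
    intro t ht U hU
    refine ⟨?_, mem_univ _, hABT t ht⟩
    rw [Metric.mem_ball, Prod.dist_eq]
    refine max_lt (lt_of_le_of_lt hU (half_lt_self hρ)) (lt_of_le_of_lt ?_ (half_lt_self hρ))
    exact hclt t ht
  have hLt : ∀ t, LipschitzOnWith L w (Metric.ball (c (cl t), cl t) ρ ∩ T) := fun t =>
    (hL _ (mem_image_of_mem _ (hcl t))).1
  have hcc : Continuous fun t => c (cl (r t)) :=
    (hc.comp_continuous hclc hcl).comp hrc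
  -- Time is clamped to `[A, B]`, the curve is continued by its end values, and the state is
  -- truncated radially to the `σ`-tube. The modified field thus samples `w` only where it is
  -- Lipschitz and is unchanged inside the tube.
  let pt : ℝ → Vec n → Vec n := fun t U => c (cl (r t)) + truncate σ (U - c (cl (r t)))
  have hpt : ∀ t U, dist (pt t U) (c (cl (r t))) ≤ σ := by
    intro t U
    simp only [pt, dist_self_add_left]
    exact norm_truncate_le hσ _
  have hptmem : ∀ t U, (pt t U, r t) ∈ Metric.ball (c (cl (r t)), cl (r t)) ρ ∩ T := fun t U =>
    hball _ (hr t) _ (hpt t U)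
  have hvL : ∀ t, LipschitzWith (L * 2) fun U => w (pt t U, r t) := by
    intro t
    refine LipschitzWith.of_dist_le_mul fun U V => ?_
    refine ((hLt (r t)).dist_le_mul _ (hptmem t U) _ (hptmem t V)).trans ?_
    have h1 : dist (pt t U, r t) (pt t V, r t) = dist (pt t U) (pt t V) := by
      rw [Prod.dist_eq, dist_self]
      exact max_eq_left dist_nonneg
    have h2 : dist (pt t U) (pt t V) ≤ 2 * dist U V := by
      simp only [pt, dist_add_left]
      have := (lipschitzWith_truncate hσ).dist_le_mul (U - c (cl (r t))) (V - c (cl (r t)))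
      simpa using this
    rw [h1, NNReal.coe_mul, mul_assoc]
    gcongr
    exact h2
  have hvc : ∀ U, Continuous fun t => w (pt t U, r t) := by
    intro U
    have hptc : Continuous fun t => (pt t U, r t) :=
      (hcc.add ((lipschitzWith_truncate hσ).continuous.comp (continuous_const.sub hcc))).prodMk hrc
    rw [continuous_iff_continuousAt]
    intro t
    have h1 := (hLt (r t)).continuousOn _ (hptmem t U)
    refine h1.tendsto.comp (tendsto_nhdsWithin_iff.2 ⟨hptc.continuousAt, ?_⟩)
    filter_upwards [hptc.continuousAt (Metric.isOpen_ball.mem_nhds (hptmem t U).1)] with s hs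
    exact ⟨hs, (hptmem s U).2⟩
  -- All truncated states at one time lie within `2 * σ` of each other, so a bound for the state `0`
  -- over the compact time interval suffices.
  have hbd : ∃ M, 0 ≤ M ∧ ∀ t U, ‖w (pt t U, r t)‖ ≤ M := by
    obtain ⟨M, hM⟩ := (isCompact_Icc (a := A) (b := B)).exists_bound_of_continuousOn
      (hvc 0).continuousOn
    have hM0 : 0 ≤ M := (norm_nonneg _).trans (hM A ⟨le_rfl, hAB⟩)
    refine ⟨M + L * (2 * σ), by positivity, fun t U => ?_⟩
    have hrr : r (r t) = r t := hrt _ (hr t)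
    have h0 := hM (r t) (hr t)
    have h00 : pt (r t) 0 = pt t 0 := by simp only [pt, hrr]
    rw [hrr, h00] at h0
    have h1 := (hLt (r t)).dist_le_mul _ (hptmem t U) _ (hptmem t 0)
    have h2 : dist (pt t U, r t) (pt t 0, r t) = dist (pt t U) (pt t 0) := by
      rw [Prod.dist_eq, dist_self]
      exact max_eq_left dist_nonneg
    have h3 : dist (pt t U) (pt t 0) ≤ 2 * σ := by
      have := dist_triangle_right (pt t U) (pt t 0) (c (cl (r t)))
      linarith [hpt t U, hpt t 0]
    rw [h2, dist_eq_norm] at h1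
    have h4 : (L : ℝ) * dist (pt t U) (pt t 0) ≤ L * (2 * σ) := by gcongr
    linarith [norm_sub_norm_le (w (pt t U, r t)) (w (pt t 0, r t))]
  obtain ⟨M, hM0, hM⟩ := hbd
  refine ⟨σ, L * 2, M, fun t U => w (pt t U, r t), hσ, hM0, hvL, hvc, hM, fun t ht U hU => ?_⟩
  have hUt := (hL _ (mem_image_of_mem _ (hcl t))).2 _ (hball t ht U hU).1
  refine ⟨hUt.1, hUt.2, ?_⟩
  have : pt t U = U := by
    simp only [pt]
    rw [hrt t ht, truncate_of_norm_le hσ (by rwa [← dist_eq_norm]), add_sub_cancel]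
  simp only [this, hrt t ht, w]
  have := congrArg (fun S : Vec n →L[ℝ] Vec n => S (P.a U t)) (Ring.mul_inverse_cancel _ hUt.2)
  simpa using this

end SteadyProblem

/-! ### Branches of the steady equation as trajectories of the velocity field. -/

namespace SteadyProblem

variable {n I : ℕ} {P : SteadyProblem n I}

theorem IsBranch.mono {s t s' t' : ℝ} {V : ℝ → Vec n} (hV : P.IsBranch s t V) (hs : s ≤ s')
    (ht : t' ≤ t) : P.IsBranch s' t' V :=
  ⟨hV.contDiffOn.mono (Icc_subset_Icc hs ht), fun x hx => hV.mem_D x (Icc_subset_Icc hs ht hx),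
    fun x hx => hV.ode x (Ioo_subset_Ioo hs ht hx)⟩

/-- `v` is a velocity field for `f(U)_x = a(U,x)` at the states at distance at most `σ` from the
curve `c` over `[A, B]`. -/
def IsVelocityNear (P : SteadyProblem n I) (v : ℝ → Vec n → Vec n) (A B σ : ℝ) (c : ℝ → Vec n) :
    Prop :=
  ∀ t ∈ Icc A B, ∀ U, dist U (c t) ≤ σ →
    U ∈ P.D ∧ IsUnit (fderiv ℝ P.f U) ∧ fderiv ℝ P.f U (v t U) = P.a U t

theorem hasFDerivAt_f {U : Vec n} (hU : U ∈ P.D) : HasFDerivAt P.f (fderiv ℝ P.f U) U :=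
  ((P.contDiffOn_f.differentiableOn (by simp)) U hU |>.differentiableAt
    (P.isOpen_D.mem_nhds hU)).hasFDerivAt

namespace IsVelocityNear

variable {v : ℝ → Vec n → Vec n} {A B σ : ℝ} {c : ℝ → Vec n} {L : NNReal}

theorem continuousOn_comp (hvL : ∀ t, LipschitzWith L (v t))
    (hvc : ∀ U, Continuous fun t => v t U) {s : Set ℝ} {V : ℝ → Vec n} (hV : ContinuousOn V s) :
    ContinuousOn (fun t => v t (V t)) s := by
  have : Continuous (Function.uncurry v) :=
    continuous_prod_of_continuous_lipschitzWith' (Function.uncurry v) L hvL hvc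
  exact this.comp_continuousOn (continuousOn_id.prodMk hV)

/-- A branch near the curve solves the differential equation. -/
theorem isSolutionOn (hv : P.IsVelocityNear v A B σ c) (hvL : ∀ t, LipschitzWith L (v t))
    (hvc : ∀ U, Continuous fun t => v t U) {s t : ℝ} (hs : A ≤ s) (hst : s < t) (ht : t ≤ B)
    {V : ℝ → Vec n} (hV : P.IsBranch s t V) (hVc : ∀ x ∈ Icc s t, dist (V x) (c x) ≤ σ) :
    IsSolutionOn v s t V := by
  have hd := hV.contDiffOn.differentiableOn (by simp)
  -- At interior points the chain rule gives `f'(V) V' = a` and `f'(V)` cancels; the end points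
  -- follow by continuity.
  have heq : EqOn (derivWithin V (Icc s t)) (fun x => v x (V x)) (Ioo s t) := by
    intro x hx
    have hx' := Ioo_subset_Icc_self hx
    have h1 := (hd x hx').hasDerivWithinAt.hasDerivAt (Icc_mem_nhds hx.1 hx.2)
    obtain ⟨hD, hu, hva⟩ := hv x ⟨hs.trans hx'.1, hx'.2.trans ht⟩ _ (hVc x hx')
    have h2 := ((hasFDerivAt_f hD).comp_hasDerivAt x h1).unique (hV.ode x hx)
    rw [← hva] at h2
    obtain ⟨S, hS⟩ := hu
    have h3 := congrArg (fun z => (↑S⁻¹ : Vec n →L[ℝ] Vec n) z) h2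
    have hinv : ∀ z, (↑S⁻¹ : Vec n →L[ℝ] Vec n) (fderiv ℝ P.f (V x) z) = z := fun z => by
      rw [← hS]
      exact congrArg (fun R : Vec n →L[ℝ] Vec n => R z) S.inv_mul
    simpa only [hinv] using h3
  have heq' := heq.of_subset_closure
    (hV.contDiffOn.continuousOn_derivWithin (uniqueDiffOn_Icc hst) (by simp))
    (continuousOn_comp hvL hvc hV.contDiffOn.continuousOn) Ioo_subset_Icc_self
    (by rw [closure_Ioo hst.ne])
  intro x hx
  rw [← show derivWithin V (Icc s t) x = v x (V x) from heq' hx]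
  exact (hd x hx).hasDerivWithinAt

/-- A solution of the differential equation near the curve is a branch. -/
theorem isBranch (hv : P.IsVelocityNear v A B σ c) (hvL : ∀ t, LipschitzWith L (v t))
    (hvc : ∀ U, Continuous fun t => v t U) {s t : ℝ} (hs : A ≤ s) (ht : t ≤ B)
    {V : ℝ → Vec n} (hV : IsSolutionOn v s t V) (hVc : ∀ x ∈ Icc s t, dist (V x) (c x) ≤ σ) :
    P.IsBranch s t V := by
  have hvx : ∀ x ∈ Icc s t, _ := fun x hx =>
    hv x ⟨hs.trans hx.1, hx.2.trans ht⟩ _ (hVc x hx)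
  refine ⟨?_, fun x hx => (hvx x hx).1, fun x hx => ?_⟩
  · rcases lt_or_ge s t with hst | hst
    · rw [show (1 : WithTop ℕ∞) = 0 + 1 from (zero_add 1).symm,
        contDiffOn_succ_iff_derivWithin (uniqueDiffOn_Icc hst)]
      refine ⟨fun x hx => (hV x hx).differentiableWithinAt, by simp, contDiffOn_zero.2 ?_⟩
      exact (continuousOn_comp hvL hvc hV.continuousOn).congr fun x hx =>
        (hV x hx).derivWithin (uniqueDiffOn_Icc hst x hx)
    · intro x hx
      have hx1 : s = t := le_antisymm (hx.1.trans hx.2) hst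
      subst hx1
      have hxs : x = s := le_antisymm hx.2 hx.1
      subst hxs
      rw [Icc_self]
      exact contDiffWithinAt_singleton
  · obtain ⟨hD, -, hva⟩ := hvx x (Ioo_subset_Icc_self hx)
    have h1 := (hV x (Ioo_subset_Icc_self hx)).hasDerivAt (Icc_mem_nhds hx.1 hx.2)
    have h2 := (hasFDerivAt_f hD).comp_hasDerivAt x h1
    rwa [hva] at h2

/-- A branch that starts like a solution near the curve coincides with it. -/
theorem branch_eqOn (hv : P.IsVelocityNear v A B σ c) (hvL : ∀ t, LipschitzWith L (v t))
    (hvc : ∀ U, Continuous fun t => v t U) (hc : Continuous c) {s t : ℝ} (hs : A ≤ s) (ht : t ≤ B)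
    {u V : ℝ → Vec n} (hu : IsSolutionOn v s t u) (huc : ∀ x ∈ Icc s t, dist (u x) (c x) < σ)
    (hV : P.IsBranch s t V) (hVu : V s = u s) : EqOn V u (Icc s t) := by
  rcases lt_or_ge t s with hts | hst
  · intro x hx
    exact absurd (hx.1.trans hx.2) (not_le.2 hts)
  have hVcont := hV.contDiffOn.continuousOn
  have hucont := hu.continuousOn
  -- Continuous induction, because `V` is not known to stay in the tube: where it agrees with `u` it
  -- is strictly inside, so it remains there for a short while and uniqueness for the differential
  -- equation applies.
  refine IsClosed.Icc_subset_of_forall_mem_nhdsWithin (s := {x | V x = u x}) ?_ hVu ?_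
  · rw [inter_comm]
    exact (hVcont.prodMk hucont).preimage_isClosed_of_isClosed isClosed_Icc isClosed_diagonal
  · rintro x ⟨hx, hxs⟩
    have hxst := Ico_subset_Icc_self hxs
    have hx' : V x = u x := hx
    have hd : dist (V x) (c x) < σ := by rw [hx']; exact huc x hxst
    have h1 : ∀ᶠ z in 𝓝[Icc s t] x, dist (V z) (c z) < σ :=
      ((hVcont x hxst).dist hc.continuousWithinAt).eventually_lt continuousWithinAt_const hd
    have h2 : ∀ᶠ z in 𝓝[≥] x, dist (V z) (c z) < σ := h1.filter_mono
      (nhdsWithin_le_of_mem (mem_of_superset (Icc_mem_nhdsGE hxs.2) (Icc_subset_Icc_left hxs.1)))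
    obtain ⟨y, hy, hyz⟩ := mem_nhdsGE_iff_exists_Icc_subset.1 h2
    set y' := min y t
    have hxy : x < y' := lt_min hy hxs.2
    have hyt : y' ≤ t := min_le_right _ _
    have hVs := hv.isSolutionOn hvL hvc (hs.trans hxs.1) hxy (hyt.trans ht)
      (hV.mono hxs.1 hyt)
      fun z hz => (hyz ⟨hz.1, hz.2.trans (min_le_left _ _)⟩).le
    have hus := hu.mono hxs.1 hyt
    have := ODE_solution_unique hvL hVs.continuousOn (fun z hz => hVs.hasDerivWithinAt_Ici hz)
      hus.continuousOn (fun z hz => hus.hasDerivWithinAt_Ici hz) hx'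
    exact mem_of_superset (Ioc_mem_nhdsGT hxy) fun z hz => this (Ioc_subset_Icc_self hz)

end IsVelocityNear

/-- `propagate` evaluates an arbitrarily chosen branch, so its value is known as soon as all
branches with these data end at the same state. -/
theorem propagate_eq {s t : ℝ} {U W : Vec n} (hex : ∃ V, P.IsBranch s t V ∧ V s = U)
    (huniq : ∀ V, P.IsBranch s t V → V s = U → V t = W) : P.propagate s t U = W := by
  rw [propagate, dif_pos hex]
  exact huniq _ hex.choose_spec.1 hex.choose_spec.2

/-- The branches near a given one exist on a slightly larger interval, are unique, and depend on
their data in a Lipschitz way. -/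
theorem exists_flow (P : SteadyProblem n I) {p q : ℝ} (hpq : p < q) (hp : P.xL ≤ p) (hq : q ≤ P.xR)
    {c : ℝ → Vec n} (hc : P.IsBranch p q c) (hf : ∀ x ∈ Icc p q, IsC11DiffeoNear P.f (c x))
    (ha : ∀ x ∈ Icc p q, ∃ s ∈ 𝓝[univ ×ˢ Icc P.xL P.xR] (c x, x), ∃ K,
      LipschitzOnWith K (Function.uncurry P.a) s) :
    ∃ δ Λ : ℝ, 0 < δ ∧ 0 ≤ Λ ∧
      (∀ s ∈ Icc (max P.xL (p - δ)) (p + δ), s ≤ min P.xR (q + δ) → ∀ U ∈ Metric.ball (c p) δ,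
        ∃ u, P.IsBranch s (min P.xR (q + δ)) u ∧ u s = U ∧
          ∀ t ∈ Icc s (min P.xR (q + δ)), P.propagate s t U = u t) ∧
      (∀ s ∈ Icc (max P.xL (p - δ)) (p + δ), ∀ s' ∈ Icc (max P.xL (p - δ)) (p + δ),
        ∀ U ∈ Metric.ball (c p) δ, ∀ U' ∈ Metric.ball (c p) δ,
        ∀ t ∈ Icc s (min P.xR (q + δ)), ∀ t' ∈ Icc s' (min P.xR (q + δ)),
          ‖P.propagate s t U - P.propagate s' t' U'‖ ≤ Λ * (|s - s'| + ‖U - U'‖ + |t - t'|)) ∧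
      (∀ t ∈ Icc p q, P.propagate p t (c p) = c t) := by
  obtain ⟨σ, L, M, v, hσ, hM0, hvL, hvc, hM, hv⟩ := P.exists_global_velocity hpq.le hp hq
    hc.contDiffOn.continuousOn hc.mem_D hf ha
  set A := max P.xL (p - σ)
  set B := min P.xR (q + σ)
  let cb : ℝ → Vec n := fun t => c (projIcc p q hpq.le t)
  have hcb : Continuous cb := hc.contDiffOn.continuousOn.comp_continuous
    (continuous_subtype_val.comp continuous_projIcc) fun t => (projIcc p q hpq.le t).2
  have hcbc : ∀ t ∈ Icc p q, cb t = c t := fun t ht => by simp only [cb]; rw [projIcc_of_mem _ ht]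
  replace hv : P.IsVelocityNear v A B σ cb := hv
  have hA : A ≤ p := max_le hp (by linarith)
  have hB : q ≤ B := le_min hq (by linarith)
  have hpAB : p ∈ Icc A B := ⟨hA, hpq.le.trans hB⟩
  -- The global flow of the modified field; the trajectory `w` below continues the given branch
  -- beyond both ends.
  choose! φ hφ0 hφ using fun s (hs : s ∈ Icc A B) U => exists_isSolutionOn hvL hvc hM hs U
  set w := φ p (c p)
  have hw : IsSolutionOn v A B w := hφ p hpAB _
  have hwp : w p = c p := hφ0 p hpAB _
  have hcsol : IsSolutionOn v p q c := hv.isSolutionOn hvL hvc hA hpq hB hc fun x hx => by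
    rw [hcbc x hx, dist_self]; exact hσ.le
  have hwc : EqOn w c (Icc p q) := by
    have hw' := hw.mono hA hB
    exact ODE_solution_unique hvL hw'.continuousOn (fun z hz => hw'.hasDerivWithinAt_Ici hz)
      hcsol.continuousOn (fun z hz => hcsol.hasDerivWithinAt_Ici hz) hwp
  set e := Real.exp (L * (B - A))
  have he : 0 < e := Real.exp_pos _
  -- The first term bounds the distance of a perturbed trajectory from `w`, the second that of `w`
  -- from the curve continued by constants. Their sum below `σ` keeps perturbed trajectories in the
  -- tube, where the field is the true one.
  obtain ⟨δ, hδ, hδσ, hδe⟩ : ∃ δ > 0, δ ≤ σ ∧ e * (δ + M * δ) + M * δ < σ := by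
    have hk : 0 < e * (1 + M) + M + 1 := by positivity
    refine ⟨min σ (σ / (e * (1 + M) + M + 1) / 2), by positivity, min_le_left _ _, ?_⟩
    have h1 : min σ (σ / (e * (1 + M) + M + 1) / 2) ≤ σ / (e * (1 + M) + M + 1) / 2 :=
      min_le_right _ _
    set d := min σ (σ / (e * (1 + M) + M + 1) / 2)
    have h2 : d * (e * (1 + M) + M + 1) ≤ σ / 2 := by
      calc _ ≤ σ / (e * (1 + M) + M + 1) / 2 * (e * (1 + M) + M + 1) := by gcongr
        _ = _ := by field_simp
    have h3 : 0 < d := by positivity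
    nlinarith
  set A' := max P.xL (p - δ)
  set B' := min P.xR (q + δ)
  have hAA' : A ≤ A' := max_le_max le_rfl (by linarith)
  have hBB' : B' ≤ B := min_le_min le_rfl (by linarith)
  have hwcb : ∀ t ∈ Icc A' B', dist (w t) (cb t) ≤ M * δ := by
    intro t ht
    have h1 : p - δ ≤ t := (le_max_right _ _).trans ht.1
    have h2 : t ≤ q + δ := ht.2.trans (min_le_right _ _)
    have htAB : t ∈ Icc A B := ⟨hAA'.trans ht.1, ht.2.trans hBB'⟩
    rcases le_total t p with h | h
    · have : cb t = w p := by
        simp only [cb]; rw [projIcc_of_le_left _ h, hwp]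
      rw [this]
      refine (hw.dist_apply_le hM hpAB htAB).trans ?_
      gcongr
      rw [abs_le]; constructor <;> linarith
    · rcases le_total t q with h' | h'
      · rw [hcbc t ⟨h, h'⟩, hwc ⟨h, h'⟩, dist_self]
        positivity
      · have : cb t = w q := by
          simp only [cb]; rw [projIcc_of_right_le _ h', hwc ⟨hpq.le, le_rfl⟩]
        rw [this]
        refine (hw.dist_apply_le hM ⟨hA.trans hpq.le, hB⟩ htAB).trans ?_
        gcongr
        rw [abs_le]; constructor <;> linarith
  have hnear : ∀ s ∈ Icc A' (p + δ), s ≤ B' → ∀ U ∈ Metric.ball (c p) δ, ∀ t ∈ Icc s B',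
      dist (φ s U t) (cb t) < σ := by
    intro s hs hsB U hU t ht
    have hsAB : s ∈ Icc A B := ⟨hAA'.trans hs.1, hsB.trans hBB'⟩
    have htAB : t ∈ Icc A B := ⟨hsAB.1.trans ht.1, ht.2.trans hBB'⟩
    have h1 := IsSolutionOn.dist_flow_le hvL hM (hφ s hsAB U) hw hsAB hpAB htAB htAB
    rw [hφ0 s hsAB, hwp, sub_self, abs_zero, mul_zero, add_zero] at h1
    have h2 : |s - p| ≤ δ := by
      have : p - δ ≤ s := (le_max_right _ _).trans hs.1
      rw [abs_le]; constructor <;> linarith [hs.2]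
    have h3 : dist U (c p) ≤ δ := (Metric.mem_ball.1 hU).le
    have h4 : e * (dist U (c p) + M * |s - p|) ≤ e * (δ + M * δ) := by gcongr
    linarith [dist_triangle (φ s U t) (w t) (cb t), hwcb t ⟨hs.1.trans ht.1, ht.2⟩]
  have hbranch : ∀ s ∈ Icc A' (p + δ), s ≤ B' → ∀ U ∈ Metric.ball (c p) δ,
      P.IsBranch s B' (φ s U) ∧ φ s U s = U ∧ ∀ t ∈ Icc s B', P.propagate s t U = φ s U t := by
    intro s hs hsB U hU
    have hsAB : s ∈ Icc A B := ⟨hAA'.trans hs.1, hsB.trans hBB'⟩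
    have hn := hnear s hs hsB U hU
    have hb := hv.isBranch hvL hvc hsAB.1 hBB' ((hφ s hsAB U).mono hsAB.1 hBB')
      fun x hx => (hn x hx).le
    refine ⟨hb, hφ0 s hsAB U, fun t ht => ?_⟩
    refine propagate_eq ⟨_, hb.mono le_rfl ht.2, hφ0 s hsAB U⟩ fun V hV hVs => ?_
    exact hv.branch_eqOn hvL hvc hcb hsAB.1 (ht.2.trans hBB')
      ((hφ s hsAB U).mono hsAB.1 (ht.2.trans hBB')) (fun x hx => hn x ⟨hx.1, hx.2.trans ht.2⟩) hV
      (hVs.trans (hφ0 s hsAB U).symm) ⟨ht.1, le_rfl⟩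
  have hA'p : A' ≤ p := max_le hp (by linarith)
  have hqB' : q ≤ B' := le_min hq (by linarith)
  refine ⟨δ, e * (1 + M) + M, hδ, by positivity, fun s hs hsB U hU => ⟨_, hbranch s hs hsB U hU⟩,
    ?_, ?_⟩
  · intro s hs s' hs' U hU U' hU' t ht t' ht'
    have hsB := ht.1.trans ht.2
    have hsB' := ht'.1.trans ht'.2
    have hsAB : s ∈ Icc A B := ⟨hAA'.trans hs.1, hsB.trans hBB'⟩
    have hsAB' : s' ∈ Icc A B := ⟨hAA'.trans hs'.1, hsB'.trans hBB'⟩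
    rw [(hbranch s hs hsB U hU).2.2 t ht, (hbranch s' hs' hsB' U' hU').2.2 t' ht', ← dist_eq_norm]
    have h1 := IsSolutionOn.dist_flow_le hvL hM (hφ s hsAB U) (hφ s' hsAB' U') hsAB hsAB'
      ⟨hsAB.1.trans ht.1, ht.2.trans hBB'⟩ ⟨hsAB'.1.trans ht'.1, ht'.2.trans hBB'⟩
    rw [hφ0 s hsAB, hφ0 s' hsAB', dist_eq_norm U] at h1
    refine h1.trans ?_
    have : 0 ≤ e * |s - s'| + e * M * ‖U - U'‖ + e * (1 + M) * |t - t'|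
      + M * (|s - s'| + ‖U - U'‖) := by positivity
    change e * _ + _ ≤ _
    nlinarith
  · intro t ht
    rw [(hbranch p ⟨hA'p, by linarith⟩ (hpq.le.trans hqB') (c p) (Metric.mem_ball_self hδ)).2.2 t
      ⟨ht.1, ht.2.trans hqB'⟩]
    exact hwc ht

end SteadyProblem

/-! ### Continuity of simple real eigenvalues. -/

namespace IsOrderedSpectrum

variable {n : ℕ} {A : Vec n →L[ℝ] Vec n} {l l' : Fin n → ℝ}

/-- Eigenvectors for `n` distinct eigenvalues form a basis that diagonalises `A`. -/
theorem det_sub_smul_one (h : IsOrderedSpectrum A l) (t : ℝ) :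
    (A - t • 1).det = ∏ i, (l i - t) := by
  choose v hv using fun i => (h.2 i).exists_hasEigenvector
  have hli : LinearIndependent ℝ v :=
    Module.End.eigenvectors_linearIndependent' (A : Vec n →ₗ[ℝ] Vec n) l h.1.injective v hv
  let b := basisOfLinearIndependentOfCardEqFinrank' v hli (by simp)
  have hb : ∀ i, b i = v i := fun i => by simp [b]
  rw [ContinuousLinearMap.det, ← LinearMap.det_toMatrix b]
  have : LinearMap.toMatrix b b ((A - t • 1 : Vec n →L[ℝ] Vec n) : Vec n →ₗ[ℝ] Vec n)
      = Matrix.diagonal fun i => l i - t := by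
    ext i j
    have hj : ((A - t • 1 : Vec n →L[ℝ] Vec n) : Vec n →ₗ[ℝ] Vec n) (b j) = (l j - t) • b j := by
      have := (hv j).apply_eq_smul
      rw [hb]
      simp only [ContinuousLinearMap.coe_coe] at this
      simp [this, sub_smul]
    rw [LinearMap.toMatrix_apply, hj, map_smul, Module.Basis.repr_self]
    rcases eq_or_ne i j with rfl | hij
    · simp
    · simp [Matrix.diagonal_apply_ne _ hij, Finsupp.single_eq_of_ne hij]
  rw [this, Matrix.det_diagonal]

theorem hasEigenvalue_of_det_eq_zero {t : ℝ} (h : (A - t • 1).det = 0) :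
    Module.End.HasEigenvalue (A : Vec n →ₗ[ℝ] Vec n) t := by
  have := LinearMap.bot_lt_ker_of_det_eq_zero h
  rw [Module.End.hasEigenvalue_iff, Module.End.eigenspace_def]
  exact this.ne'

theorem det_eq_zero (h : IsOrderedSpectrum A l) (i : Fin n) : (A - l i • 1).det = 0 := by
  rw [h.det_sub_smul_one]
  exact Finset.prod_eq_zero (Finset.mem_univ i) (sub_self _)

theorem unique (h : IsOrderedSpectrum A l) (h' : IsOrderedSpectrum A l') : l = l' := by
  have sub : ∀ {l l' : Fin n → ℝ}, IsOrderedSpectrum A l → IsOrderedSpectrum A l' →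
      range l ⊆ range l' := by
    rintro l l' h h' _ ⟨i, rfl⟩
    have := h.det_eq_zero i
    rw [h'.det_sub_smul_one] at this
    obtain ⟨j, -, hj⟩ := Finset.prod_eq_zero_iff.1 this
    exact ⟨j, sub_eq_zero.1 hj⟩
  exact (StrictMono.range_inj h.1 h'.1).1 ((sub h h').antisymm (sub h' h))

/-- Real distinct eigenvalues depend continuously on the matrix. -/
theorem eventually_exists (h : IsOrderedSpectrum A l) {ε : ℝ} (hε : 0 < ε) :
    ∀ᶠ B in 𝓝 A, ∃ l', IsOrderedSpectrum B l' ∧ ∀ i, |l' i - l i| < ε := by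
  -- The windows of radius `η` about the eigenvalues are disjoint, so roots found in them are
  -- automatically in increasing order.
  obtain ⟨η, hη, hηε, hgap⟩ : ∃ η > 0, η < ε ∧ ∀ i j, i ≠ j → 2 * η < |l i - l j| := by
    have h1 : ∀ᶠ η in 𝓝[>] (0 : ℝ), ∀ i j, i ≠ j → 2 * η < |l i - l j| := by
      refine eventually_all.2 fun i => eventually_all.2 fun j => ?_
      by_cases hij : i = j
      · exact Eventually.of_forall fun η hne => absurd hij hne
      · have hpos : 0 < |l i - l j| := abs_pos.2 (sub_ne_zero.2 (h.1.injective.ne hij))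
        have : ∀ᶠ η in 𝓝 (0 : ℝ), 2 * η < |l i - l j| :=
          (continuous_const.mul continuous_id).continuousAt.eventually_lt continuousAt_const
            (by simpa using hpos)
        exact (this.filter_mono nhdsWithin_le_nhds).mono fun η hη _ => hη
    obtain ⟨η, h2, h3, h4⟩ := (h1.and ((Ioo_mem_nhdsGT hε))).exists
    exact ⟨η, h3, h4, h2⟩
  have hF : ∀ t : ℝ, Continuous fun B : Vec n →L[ℝ] Vec n => (B - t • 1).det := fun t =>
    ContinuousLinearMap.continuous_det.comp (continuous_id.sub continuous_const)
  -- The characteristic determinant changes sign across each window: in the product the factor of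
  -- index `i` is `-η ^ 2` and the others are positive. This strict inequality survives
  -- perturbation, and the intermediate value theorem returns a root.
  have hneg : ∀ i, (A - (l i - η) • 1).det * (A - (l i + η) • 1).det < 0 := by
    intro i
    rw [h.det_sub_smul_one, h.det_sub_smul_one, ← Finset.prod_mul_distrib,
      ← Finset.mul_prod_erase _ _ (Finset.mem_univ i)]
    refine mul_neg_of_neg_of_pos (by nlinarith) (Finset.prod_pos fun j hj => ?_)
    have hg := hgap j i (Finset.ne_of_mem_erase hj)
    have : η ^ 2 < (l j - l i) ^ 2 := by
      rw [← sq_abs (l j - l i)]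
      gcongr
      linarith
    nlinarith
  have hev : ∀ᶠ B in 𝓝 A, ∀ i, (B - (l i - η) • 1).det * (B - (l i + η) • 1).det < 0 :=
    eventually_all.2 fun i => ((hF _).mul (hF _)).continuousAt.eventually_lt continuousAt_const
      (hneg i)
  filter_upwards [hev] with B hB
  have hroot : ∀ i, ∃ t, |t - l i| ≤ η ∧ (B - t • 1).det = 0 := by
    intro i
    have hc : Continuous fun t : ℝ => (B - t • 1).det :=
      ContinuousLinearMap.continuous_det.comp (by fun_prop)
    have hle : l i - η ≤ l i + η := by linarith
    have hex : ∃ t ∈ Icc (l i - η) (l i + η), (B - t • 1).det = 0 := by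
      rcases mul_neg_iff.1 (hB i) with ⟨h1, h2⟩ | ⟨h1, h2⟩
      · exact intermediate_value_Icc' hle hc.continuousOn ⟨h2.le, h1.le⟩
      · exact intermediate_value_Icc hle hc.continuousOn ⟨h1.le, h2.le⟩
    obtain ⟨t, ht, ht0⟩ := hex
    exact ⟨t, abs_le.2 ⟨by linarith [ht.1], by linarith [ht.2]⟩, ht0⟩
  choose l' hl' hl'0 using hroot
  refine ⟨l', ⟨fun i j hij => ?_, fun i => hasEigenvalue_of_det_eq_zero (hl'0 i)⟩,
    fun i => (hl' i).trans_lt hηε⟩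
  have h1 := hgap j i hij.ne'
  have h2 := h.1 hij
  rw [abs_of_pos (by linarith)] at h1
  linarith [(abs_le.1 (hl' i)).2, (abs_le.1 (hl' j)).1]

end IsOrderedSpectrum

/-! ### Stability of Lax shocks and the jump operator. -/

namespace SteadyProblem

variable {n I : ℕ} {P : SteadyProblem n I}

theorem continuousAt_fderiv_f {U : Vec n} (hU : U ∈ P.D) : ContinuousAt (fderiv ℝ P.f) U :=
  (P.contDiffOn_f.continuousOn_fderiv_of_isOpen P.isOpen_D (by simp)).continuousAt
    (P.isOpen_D.mem_nhds hU)

/-- For equal states the unique spectrum would have a `λ_k` of both signs. The resulting gap between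
the two sides is what locates the shock in `injOn_shoot`. -/
theorem IsLaxShock.ne {U V : Vec n} (h : P.IsLaxShock U V) : U ≠ V := by
  rintro rfl
  obtain ⟨-, -, -, lU, lV, k, hU, hV, h1, h2, -⟩ := h
  rw [hU.unique hV] at h2
  linarith

/-- The Lax inequalities persist under small perturbations of the two states. -/
theorem IsLaxShock.eventually {U V : Vec n} (h : P.IsLaxShock U V) :
    ∀ᶠ p : Vec n × Vec n in 𝓝 (U, V), P.f p.2 = P.f p.1 → P.IsLaxShock p.1 p.2 := by
  obtain ⟨hUD, hVD, -, lU, lV, k, hU, hV, hVk, hUk, hUj, hVj⟩ := h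
  -- Eigenvalues that move by less than the smallest nonzero modulus keep their signs.
  obtain ⟨ε, hε, hUε, hVε⟩ : ∃ ε > 0, (∀ i, lU i ≠ 0 → ε ≤ |lU i|) ∧ (∀ i, lV i ≠ 0 → ε ≤ |lV i|) := by
    have aux : ∀ l : Fin n → ℝ, ∀ᶠ ε in 𝓝[>] (0 : ℝ), ∀ i, l i ≠ 0 → ε ≤ |l i| := by
      refine fun l => eventually_all.2 fun i => ?_
      by_cases hi : l i = 0
      · exact Eventually.of_forall fun ε hne => absurd hi hne
      · filter_upwards [Ioo_mem_nhdsGT (abs_pos.2 hi)] with ε hε _ using hε.2.le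
    obtain ⟨ε, ⟨h1, h2⟩, h3⟩ := (((aux lU).and (aux lV)).and self_mem_nhdsWithin).exists
    exact ⟨ε, h3, h1, h2⟩
  have e1 := (continuousAt_fderiv_f hUD).eventually (hU.eventually_exists hε)
  have e2 := (continuousAt_fderiv_f hVD).eventually (hV.eventually_exists hε)
  have e3 := P.isOpen_D.mem_nhds hUD
  have e4 := P.isOpen_D.mem_nhds hVD
  rw [nhds_prod_eq]
  filter_upwards [(e1.and e3).prod_mk (e2.and e4)] with p hp hf
  obtain ⟨⟨⟨lU', hU', hdU⟩, hpU⟩, ⟨lV', hV', hdV⟩, hpV⟩ := hp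
  have neg : ∀ {x y : ℝ}, |x - y| < ε → (y ≠ 0 → ε ≤ |y|) → y < 0 → x < 0 := by
    intro x y h1 h2 h3
    have := h2 h3.ne
    rw [abs_of_neg h3] at this
    linarith [(abs_lt.1 h1).2]
  have pos : ∀ {x y : ℝ}, |x - y| < ε → (y ≠ 0 → ε ≤ |y|) → 0 < y → 0 < x := by
    intro x y h1 h2 h3
    have := h2 h3.ne'
    rw [abs_of_pos h3] at this
    linarith [(abs_lt.1 h1).1]
  exact ⟨hpU, hpV, hf, lU', lV', k, hU', hV', neg (hdV k) (hVε k) hVk, pos (hdU k) (hUε k) hUk,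
    fun j hj => neg (hdU j) (hUε j) (hUj j hj), fun j hj => pos (hdV j) (hVε j) (hVj j hj)⟩

/-- Near a Lax shock the jump operator is a Lipschitz map to Lax shocks. -/
theorem IsLaxShock.exists_jump {U₀ V₀ : Vec n} (h : P.IsLaxShock U₀ V₀)
    (hf : IsC11DiffeoNear P.f V₀) :
    ∃ δ > 0, (∀ U ∈ Metric.ball U₀ δ, P.IsLaxShock U (P.jump V₀ U)) ∧ P.jump V₀ U₀ = V₀ ∧
      ∃ L, LipschitzOnWith L (P.jump V₀) (Metric.ball U₀ δ) := by
  obtain ⟨φ, hV, hfφ, -, hψd, Kψ, hψK⟩ := hf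
  have hfU : P.f U₀ = φ V₀ := by rw [← h.2.2.1, hfφ hV]
  have ht : P.f U₀ ∈ φ.target := by rw [hfU]; exact φ.map_source hV
  have hψ : φ.symm (P.f U₀) = V₀ := by rw [hfU, φ.left_inv hV]
  have hstrict : HasStrictFDerivAt φ.symm (fderiv ℝ φ.symm (P.f U₀)) (P.f U₀) := by
    refine hasStrictFDerivAt_of_hasFDerivAt_of_continuousAt ?_
      ((hψK.continuousOn _ ht).continuousAt (φ.open_target.mem_nhds ht))
    filter_upwards [φ.open_target.mem_nhds ht] with z hz
    exact ((hψd z hz).differentiableAt (φ.open_target.mem_nhds hz)).hasFDerivAt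
  have hfstrict : HasStrictFDerivAt P.f (fderiv ℝ P.f U₀) U₀ :=
    (P.contDiffOn_f.contDiffAt (P.isOpen_D.mem_nhds h.1)).hasStrictFDerivAt (by simp)
  have hcomp := hstrict.comp U₀ hfstrict
  obtain ⟨L, s, hs, hL⟩ := hcomp.exists_lipschitzOnWith
  obtain ⟨r, hr, hrs⟩ := Metric.isOpen_iff.1 φ.open_source V₀ hV
  have hc : Tendsto (fun U => φ.symm (P.f U)) (𝓝 U₀) (𝓝 V₀) := by
    have := hcomp.hasFDerivAt.continuousAt.tendsto
    simpa only [Function.comp_apply, hψ] using! this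
  have ev1 : ∀ᶠ U in 𝓝 U₀, P.f U ∈ φ.target :=
    hfstrict.hasFDerivAt.continuousAt (φ.open_target.mem_nhds ht)
  have ev2 : ∀ᶠ U in 𝓝 U₀, φ.symm (P.f U) ∈ Metric.ball V₀ r := hc (Metric.ball_mem_nhds _ hr)
  have ev3 := (tendsto_id.prodMk_nhds hc).eventually h.eventually
  -- Within the ball of radius `r` the Rankine–Hugoniot condition has only the solution given by the
  -- local inverse of the flux. Any other Lax state lies outside that ball, so the selection of the
  -- closest one returns the local inverse.
  have key : ∀ᶠ U in 𝓝 U₀, P.IsLaxShock U (φ.symm (P.f U)) ∧ P.jump V₀ U = φ.symm (P.f U) := by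
    filter_upwards [ev1, ev2, ev3] with U h1 h2 h3
    have hlax : P.IsLaxShock U (φ.symm (P.f U)) := by
      refine h3 ?_
      change P.f (φ.symm (P.f U)) = P.f U
      rw [hfφ (φ.map_target h1), φ.right_inv h1]
    have huniq : ∀ V, P.IsLaxShock U V → V ∈ Metric.ball V₀ r → V = φ.symm (P.f U) := by
      intro V hV hVr
      rw [← hV.2.2.1, hfφ (hrs hVr), φ.left_inv (hrs hVr)]
    have hex : ∃ V, P.IsLaxShock U V ∧ ∀ V', P.IsLaxShock U V' → dist V V₀ ≤ dist V' V₀ := by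
      refine ⟨_, hlax, fun V' hV' => ?_⟩
      by_cases hb : V' ∈ Metric.ball V₀ r
      · rw [huniq V' hV' hb]
      · exact (Metric.mem_ball.1 h2).le.trans (not_lt.1 hb)
    refine ⟨hlax, ?_⟩
    rw [jump, dif_pos hex]
    exact huniq _ hex.choose_spec.1 ((hex.choose_spec.2 _ hlax).trans_lt h2)
  obtain ⟨δ, hδ, hball⟩ := Metric.mem_nhds_iff.1 (inter_mem key hs)
  refine ⟨δ, hδ, fun U hU => ?_, ?_, L, ?_⟩
  · obtain ⟨⟨h1, h2⟩, -⟩ := hball hU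
    rwa [h2]
  · rw [(hball (Metric.mem_ball_self hδ)).1.2, hψ]
  · intro U hU V hV
    rw [(hball hU).1.2, (hball hV).1.2]
    exact hL (hball hU).2 (hball hV).2

end SteadyProblem

/-! ### The exact shooting function near the exact parameters. -/

namespace SteadyProblem

variable {n I : ℕ}

/-- `K` is a neighbourhood of `(α, xS)` on which the exact shooting problem is solvable, with all
states within `ρ` of the given solution, and the ingredients of the shooting function are
`Λ`-Lipschitz on the balls of radius `2 * ρ` about the states of that solution. -/
structure IsShootingNhd (P : SteadyProblem n I) (α : Vec I) (xS : ℝ) (Um Up : ℝ → Vec n)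
    (ρ Λ : ℝ) (K : Set (Vec I × ℝ)) : Prop where
  mem_nhds : K ∈ 𝓝 (α, xS)
  -- Allows the left branch of one solution to be evaluated at the shock location of another.
  swap : ∀ y ∈ K, ∀ y' ∈ K, (y.1, y'.2) ∈ K
  mem_Ioo : ∀ y ∈ K, y.2 ∈ Ioo P.xL P.xR
  near : ∀ y ∈ K, ‖y.1 - α‖ < ρ ∧ |y.2 - xS| < ρ
  UL_mem : ∀ y ∈ K, P.UL y.1 ∈ Metric.ball (Um P.xL) ρ
  UL_continuousOn : ContinuousOn (fun y : Vec I × ℝ => P.UL y.1) K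
  UL_inj : ∀ y ∈ K, ∀ y' ∈ K, P.UL y.1 = P.UL y'.1 → y.1 = y'.1
  front_mem : ∀ y ∈ K, P.propagate P.xL y.2 (P.UL y.1) ∈ Metric.ball (Um xS) ρ
  back_mem : ∀ y ∈ K,
    P.jump (Up xS) (P.propagate P.xL y.2 (P.UL y.1)) ∈ Metric.ball (Up xS) ρ
  end_mem : ∀ y ∈ K, P.propagate y.2 P.xR (P.jump (Up xS) (P.propagate P.xL y.2 (P.UL y.1))) ∈
    Metric.ball (Up P.xR) ρ
  -- Exact states stay within `ρ`; the doubled radius leaves room for the discrete ones.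
  jump_le : ∀ U ∈ Metric.ball (Um xS) (2 * ρ), ∀ U' ∈ Metric.ball (Um xS) (2 * ρ),
    ‖P.jump (Up xS) U - P.jump (Up xS) U'‖ ≤ Λ * ‖U - U'‖
  propagate_le : ∀ y ∈ K, ∀ U ∈ Metric.ball (Up xS) (2 * ρ), ∀ U' ∈ Metric.ball (Up xS) (2 * ρ),
    ∀ x ∈ Icc y.2 P.xR, ‖P.propagate y.2 x U - P.propagate y.2 x U'‖ ≤ Λ * ‖U - U'‖
  BR_le : ∀ U ∈ Metric.ball (Up P.xR) (2 * ρ), ∀ U' ∈ Metric.ball (Up P.xR) (2 * ρ),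
    ‖P.BR U - P.BR U'‖ ≤ Λ * ‖U - U'‖
  shoot_continuousOn : ContinuousOn (P.shoot P.propagate (P.jump (Up xS))) K
  shoot_eq_zero : P.shoot P.propagate (P.jump (Up xS)) (α, xS) = 0
  sol : ∀ y ∈ K, ∃ Um' Up' : ℝ → Vec n,
    P.IsShockSolution (P.shoot P.propagate (P.jump (Up xS)) y) y.1 y.2 Um' Up' ∧
    EqOn (fun x => P.propagate P.xL x (P.UL y.1)) Um' (Icc P.xL y.2) ∧
    EqOn (fun x => P.propagate y.2 x (P.jump (Up xS) (P.propagate P.xL y.2 (P.UL y.1)))) Up'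
      (Icc y.2 P.xR) ∧
    Up' y.2 = P.jump (Up xS) (P.propagate P.xL y.2 (P.UL y.1))

theorem continuousOn_of_norm_sub_le {X E : Type*} [TopologicalSpace X] [NormedAddCommGroup E]
    {g U : X → E} {s t : X → ℝ} {Λ : ℝ} {S : Set X}
    (hg : ∀ y ∈ S, ∀ y' ∈ S, ‖g y - g y'‖ ≤ Λ * (|s y - s y'| + ‖U y - U y'‖ + |t y - t y'|))
    (hs : ContinuousOn s S) (ht : ContinuousOn t S) (hU : ContinuousOn U S) :
    ContinuousOn g S := by
  intro y hy
  have h1 : ContinuousOn (fun y' => Λ * (|s y' - s y| + ‖U y' - U y‖ + |t y' - t y|)) S :=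
    continuousOn_const.mul ((((hs.sub continuousOn_const).abs).add
      ((hU.sub continuousOn_const).norm)).add ((ht.sub continuousOn_const).abs))
  have h2 := (h1 y hy).tendsto
  rw [sub_self, sub_self, sub_self, abs_zero, norm_zero, add_zero, add_zero, mul_zero] at h2
  refine tendsto_iff_norm_sub_tendsto_zero.2 (squeeze_zero' (Eventually.of_forall fun _ =>
    norm_nonneg _) ?_ h2)
  filter_upwards [self_mem_nhdsWithin] with y' hy'
  exact hg y' hy' y hy

/-- The shooting function is a chain of locally Lipschitz or continuous maps. The neighbourhood is
shrunk once per link, so that each intermediate state lies where the next map is controlled. -/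
theorem WellPosed.exists_shootingNhd {P : SteadyProblem n I} {α : Vec I} {xS : ℝ}
    {Um Up : ℝ → Vec n} (hP : P.WellPosed α xS Um Up) {ρ₀ : ℝ} (hρ₀ : 0 < ρ₀) :
    ∃ ρ Λ K, 0 < ρ ∧ ρ ≤ ρ₀ ∧ 0 ≤ Λ ∧ P.IsShootingNhd α xS Um Up ρ Λ K := by
  have hsol := hP.sol
  have hxS := hsol.mem_Ioo
  obtain ⟨δ₁, Λ₁, hδ₁, hΛ₁, hbr₁, hlip₁, heq₁⟩ := P.exists_flow hxS.1 le_rfl hxS.2.le hsol.left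
    hP.flux_left hP.source_left
  obtain ⟨δ₂, Λ₂, hδ₂, hΛ₂, hbr₂, hlip₂, heq₂⟩ := P.exists_flow hxS.2 hxS.1.le le_rfl hsol.right
    hP.flux_right hP.source_right
  rw [min_eq_left (by linarith : P.xR ≤ P.xR + δ₂)] at hbr₂ hlip₂
  obtain ⟨δ₃, hδ₃, hlax, hjump, L₃, hL₃⟩ := hsol.lax.exists_jump
    (hP.flux_right xS ⟨le_rfl, hxS.2.le⟩)
  obtain ⟨sα, hsα, Lα, hLα⟩ := hP.UL_lipschitz
  obtain ⟨tα, htα, hinj⟩ := hP.UL_injOn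
  obtain ⟨sB, hsB, LB, hLB⟩ := hP.BR_lipschitz
  obtain ⟨δ₄, hδ₄, hδ₄B⟩ := Metric.mem_nhds_iff.1 hsB
  obtain ⟨ρ, hρ, hρ0, hρ1, hρ2, hρ3, hρ4⟩ : ∃ ρ > 0, ρ ≤ ρ₀ ∧ ρ ≤ δ₁ ∧ 2 * ρ ≤ δ₂ ∧ 2 * ρ ≤ δ₃ ∧
      2 * ρ ≤ δ₄ := by
    refine ⟨min ρ₀ (min δ₁ (min (δ₂ / 2) (min (δ₃ / 2) (δ₄ / 2)))), by positivity, ?_, ?_, ?_, ?_, ?_⟩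
    · exact min_le_left _ _
    · exact (min_le_right _ _).trans (min_le_left _ _)
    · have : min ρ₀ (min δ₁ (min (δ₂ / 2) (min (δ₃ / 2) (δ₄ / 2)))) ≤ δ₂ / 2 := by simp
      linarith
    · have : min ρ₀ (min δ₁ (min (δ₂ / 2) (min (δ₃ / 2) (δ₄ / 2)))) ≤ δ₃ / 2 := by simp
      linarith
    · have : min ρ₀ (min δ₁ (min (δ₂ / 2) (min (δ₃ / 2) (δ₄ / 2)))) ≤ δ₄ / 2 := by simp
      linarith
  -- The left branch continues past `xS` up to `B₁`, so the shock may move to either side.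
  set B₁ := min P.xR (xS + δ₁)
  have hB₁ : xS < B₁ := lt_min hxS.2 (by linarith)
  let y₀ : Vec I × ℝ := (α, xS)
  let W : Vec I × ℝ → Vec n := fun y => P.propagate P.xL y.2 (P.UL y.1)
  let V : Vec I × ℝ → Vec n := fun y => P.jump (Up xS) (W y)
  let R : Vec I × ℝ → Vec n := fun y => P.propagate y.2 P.xR (V y)
  have hW₀ : W y₀ = Um xS := by
    change P.propagate P.xL xS (P.UL α) = _
    rw [← hsol.left_bc, heq₁ xS ⟨hxS.1.le, le_rfl⟩]
  have hV₀ : V y₀ = Up xS := by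
    change P.jump (Up xS) (W y₀) = _
    rw [hW₀, hjump]
  have hR₀ : R y₀ = Up P.xR := by
    change P.propagate xS P.xR (V y₀) = _
    rw [hV₀, heq₂ P.xR ⟨hxS.2.le, le_rfl⟩]
  have hxLmem : P.xL ∈ Icc (max P.xL (P.xL - δ₁)) (P.xL + δ₁) :=
    ⟨max_le le_rfl (by linarith), by linarith⟩
  -- successive neighbourhoods
  have hULc : ContinuousAt P.UL α := (hLα.continuousOn α (mem_of_mem_nhds hsα)).continuousAt hsα
  have ev₁ : ∀ᶠ y in 𝓝 y₀, (y.1 ∈ sα ∧ y.1 ∈ tα ∧ P.UL y.1 ∈ Metric.ball (Um P.xL) ρ) ∧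
      y.2 ∈ Ioo P.xL B₁ ∧ ‖y.1 - α‖ < ρ ∧ |y.2 - xS| < ρ := by
    have c1 : Tendsto (fun y : Vec I × ℝ => y.1) (𝓝 y₀) (𝓝 α) := continuous_fst.tendsto y₀
    have c2 : Tendsto (fun y : Vec I × ℝ => y.2) (𝓝 y₀) (𝓝 xS) := continuous_snd.tendsto y₀
    have hball : P.UL ⁻¹' Metric.ball (Um P.xL) ρ ∈ 𝓝 α :=
      hULc (by rw [hsol.left_bc]; exact Metric.ball_mem_nhds _ hρ)
    filter_upwards [c1 hsα, c1 htα, c1 hball, c2 (Ioo_mem_nhds hxS.1 hB₁),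
      c1 (Metric.ball_mem_nhds α hρ), c2 (Metric.ball_mem_nhds xS hρ)] with y e1 e2 e3 e4 e5 e6
    exact ⟨⟨e1, e2, e3⟩, e4, mem_ball_iff_norm.1 e5, mem_ball_iff_norm.1 e6⟩
  obtain ⟨r₁, hr₁, hN₁⟩ := Metric.eventually_nhds_iff_ball.1 ev₁
  have hULN : ContinuousOn (fun y : Vec I × ℝ => P.UL y.1) (Metric.ball y₀ r₁) :=
    hLα.continuousOn.comp continuousOn_fst fun y hy => (hN₁ y hy).1.1
  have hWc : ContinuousOn W (Metric.ball y₀ r₁) := by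
    have hm : ∀ y ∈ Metric.ball y₀ r₁, y.2 ∈ Icc P.xL B₁ ∧ P.UL y.1 ∈ Metric.ball (Um P.xL) δ₁ :=
      fun y hy => ⟨Ioo_subset_Icc_self (hN₁ y hy).2.1,
        Metric.ball_subset_ball hρ1 (hN₁ y hy).1.2.2⟩
    exact continuousOn_of_norm_sub_le (s := fun _ => P.xL) (t := fun y => y.2)
      (fun y hy y' hy' => hlip₁ _ hxLmem _ hxLmem _ (hm y hy).2 _ (hm y' hy').2 _ (hm y hy).1 _
        (hm y' hy').1) continuousOn_const continuousOn_snd hULN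
  have ev₂ : ∀ᶠ y in 𝓝 y₀, W y ∈ Metric.ball (Um xS) ρ ∧ y ∈ Metric.ball y₀ r₁ := by
    refine (((hWc y₀ (Metric.mem_ball_self hr₁)).continuousAt
      (Metric.ball_mem_nhds _ hr₁)).eventually ?_).and (Metric.ball_mem_nhds _ hr₁)
    rw [hW₀]
    exact Metric.ball_mem_nhds _ hρ
  obtain ⟨r₂, hr₂, hN₂⟩ := Metric.eventually_nhds_iff_ball.1 ev₂
  have hVc : ContinuousOn V (Metric.ball y₀ r₂) :=
    hL₃.continuousOn.comp (hWc.mono fun y hy => (hN₂ y hy).2) fun y hy =>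
      Metric.ball_subset_ball (by linarith) (hN₂ y hy).1
  have ev₃ : ∀ᶠ y in 𝓝 y₀, V y ∈ Metric.ball (Up xS) ρ ∧ y ∈ Metric.ball y₀ r₂ := by
    refine (((hVc y₀ (Metric.mem_ball_self hr₂)).continuousAt
      (Metric.ball_mem_nhds _ hr₂)).eventually ?_).and (Metric.ball_mem_nhds _ hr₂)
    rw [hV₀]
    exact Metric.ball_mem_nhds _ hρ
  obtain ⟨r₃, hr₃, hN₃⟩ := Metric.eventually_nhds_iff_ball.1 ev₃
  have hyS : ∀ y ∈ Metric.ball y₀ r₁, y.2 ∈ Icc (max P.xL (xS - δ₂)) (xS + δ₂) ∧ y.2 ≤ P.xR := by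
    intro y hy
    obtain ⟨-, h1, -, h2⟩ := hN₁ y hy
    rw [abs_lt] at h2
    exact ⟨⟨max_le h1.1.le (by linarith), by linarith⟩, h1.2.le.trans (min_le_left _ _)⟩
  have hRc : ContinuousOn R (Metric.ball y₀ r₃) := by
    have hm : ∀ y ∈ Metric.ball y₀ r₃, (y.2 ∈ Icc (max P.xL (xS - δ₂)) (xS + δ₂) ∧
        P.xR ∈ Icc y.2 P.xR) ∧ V y ∈ Metric.ball (Up xS) δ₂ := by
      intro y hy
      have h := hyS y (hN₂ y (hN₃ y hy).2).2
      exact ⟨⟨h.1, h.2, le_rfl⟩, Metric.ball_subset_ball (by linarith) (hN₃ y hy).1⟩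
    exact continuousOn_of_norm_sub_le (s := fun y => y.2) (t := fun _ => P.xR)
      (fun y hy y' hy' => hlip₂ _ (hm y hy).1.1 _ (hm y' hy').1.1 _ (hm y hy).2 _ (hm y' hy').2 _
        (hm y hy).1.2 _ (hm y' hy').1.2) continuousOn_snd continuousOn_const
      (hVc.mono fun y hy => (hN₃ y hy).2)
  have ev₄ : ∀ᶠ y in 𝓝 y₀, R y ∈ Metric.ball (Up P.xR) ρ ∧ y ∈ Metric.ball y₀ r₃ := by
    refine (((hRc y₀ (Metric.mem_ball_self hr₃)).continuousAt
      (Metric.ball_mem_nhds _ hr₃)).eventually ?_).and (Metric.ball_mem_nhds _ hr₃)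
    rw [hR₀]
    exact Metric.ball_mem_nhds _ hρ
  obtain ⟨r, hr, hN⟩ := Metric.eventually_nhds_iff_ball.1 ev₄
  have h3 : ∀ y ∈ Metric.ball y₀ r, _ := fun y hy => hN₃ y (hN y hy).2
  have h2 : ∀ y ∈ Metric.ball y₀ r, _ := fun y hy => hN₂ y (h3 y hy).2
  have h1 : ∀ y ∈ Metric.ball y₀ r, _ := fun y hy => hN₁ y (h2 y hy).2
  have hS : ∀ y ∈ Metric.ball y₀ r, _ := fun y hy => hyS y (h2 y hy).2
  have hB4 : Metric.ball (Up P.xR) (2 * ρ) ⊆ sB := (Metric.ball_subset_ball hρ4).trans hδ₄B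
  refine ⟨ρ, max L₃ (max Λ₂ LB), Metric.ball y₀ r, hρ, hρ0, le_max_of_le_left L₃.2, ?_⟩
  refine
    { mem_nhds := Metric.ball_mem_nhds _ hr
      swap := fun y hy y' hy' => ?_
      mem_Ioo := fun y hy =>
        ⟨(h1 y hy).2.1.1, (h1 y hy).2.1.2.trans_le (min_le_left _ _)⟩
      near := fun y hy => (h1 y hy).2.2
      UL_mem := fun y hy => (h1 y hy).1.2.2
      UL_continuousOn := hULN.mono fun y hy => (h2 y hy).2
      UL_inj := fun y hy y' hy' h => hinj (h1 y hy).1.2.1 (h1 y' hy').1.2.1 h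
      front_mem := fun y hy => (h2 y hy).1
      back_mem := fun y hy => (h3 y hy).1
      end_mem := fun y hy => (hN y hy).1
      jump_le := fun U hU U' hU' => ?_
      propagate_le := fun y hy U hU U' hU' x hx => ?_
      BR_le := fun U hU U' hU' => ?_
      shoot_continuousOn := ?_
      shoot_eq_zero := ?_
      sol := fun y hy => ?_ }
  -- Balls for the maximum metric are products of balls.
  · rw [Metric.mem_ball, Prod.dist_eq, max_lt_iff] at hy hy' ⊢
    exact ⟨hy.1, hy'.2⟩
  · rw [← dist_eq_norm, ← dist_eq_norm]
    refine (hL₃.dist_le_mul _ (Metric.ball_subset_ball hρ3 hU) _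
      (Metric.ball_subset_ball hρ3 hU')).trans ?_
    gcongr
    exact le_max_left _ _
  · have := hlip₂ _ (hS y hy).1 _ (hS y hy).1 _ (Metric.ball_subset_ball hρ2 hU) _
      (Metric.ball_subset_ball hρ2 hU') _ hx _ hx
    simp only [sub_self, abs_zero, zero_add, add_zero] at this
    refine this.trans ?_
    gcongr
    exact (le_max_left _ _).trans (le_max_right _ _)
  · rw [← dist_eq_norm, ← dist_eq_norm]
    refine (hLB.dist_le_mul _ (hB4 hU) _ (hB4 hU')).trans ?_
    gcongr
    exact (le_max_right _ _).trans (le_max_right _ _)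
  · exact hLB.continuousOn.comp (hRc.mono fun y hy => (hN y hy).2) fun y hy =>
      hB4 (Metric.ball_subset_ball (by linarith) (hN y hy).1)
  · change P.BR (R y₀) = 0
    rw [hR₀, hsol.right_bc]
  · obtain ⟨Um', hUm', hUmL, hUmeq⟩ := hbr₁ P.xL hxLmem
      (hxS.1.le.trans hB₁.le) (P.UL y.1) (Metric.ball_subset_ball hρ1 (h1 y hy).1.2.2)
    obtain ⟨Up', hUp', hUpL, hUpeq⟩ := hbr₂ y.2 (hS y hy).1 (hS y hy).2 (V y)
      (Metric.ball_subset_ball (by linarith) (h3 y hy).1)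
    have hyB := (h1 y hy).2.1
    have hWy : W y = Um' y.2 := hUmeq y.2 (Ioo_subset_Icc_self hyB)
    refine ⟨Um', Up', ⟨⟨hyB.1, hyB.2.trans_le (min_le_left _ _)⟩, hUm'.mono le_rfl hyB.2.le, hUmL,
      ?_, hUp', ?_⟩, fun x hx => hUmeq x ⟨hx.1, hx.2.trans hyB.2.le⟩, hUpeq, hUpL⟩
    · rw [hUpL, ← hWy]
      exact hlax _ (Metric.ball_subset_ball (by linarith) (h2 y hy).1)
    · rw [← hUpeq P.xR ⟨(hS y hy).2, le_rfl⟩]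
      rfl

end SteadyProblem

/-! ### Injectivity of the shooting function and consistency of its discretization. -/

namespace SteadyProblem

variable {n I : ℕ} {P : SteadyProblem n I}

theorem aestronglyMeasurable_twoStates {A B xS : ℝ} {Um Up : ℝ → Vec n}
    (hm : AEStronglyMeasurable Um (volume.restrict (Icc A xS)))
    (hp : AEStronglyMeasurable Up (volume.restrict (Icc xS B))) :
    AEStronglyMeasurable (twoStates xS Um Up) (volume.restrict (Ioo A B)) := by
  have : twoStates xS Um Up = (Iic xS).piecewise Um Up := by
    ext1 x
    by_cases hx : x ≤ xS <;> simp [twoStates, Set.piecewise, hx]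
  rw [this]
  refine AEStronglyMeasurable.piecewise measurableSet_Iic ?_ ?_
  · rw [Measure.restrict_restrict measurableSet_Iic]
    have hsub : Iic xS ∩ Ioo A B ⊆ Icc A xS := fun x hx => ⟨hx.2.1.le, hx.1⟩
    exact hm.mono_measure (Measure.restrict_mono hsub le_rfl)
  · rw [Measure.restrict_restrict measurableSet_Iic.compl]
    have hsub : (Iic xS)ᶜ ∩ Ioo A B ⊆ Icc xS B := fun x hx => ⟨(notMem_Iic.1 hx.1).le, hx.2.2.le⟩
    exact hp.mono_measure (Measure.restrict_mono hsub le_rfl)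

theorem IsShockSolution.aestronglyMeasurable {b : Vec (I + 1)} {α : Vec I} {xS : ℝ}
    {Um Up : ℝ → Vec n} (h : P.IsShockSolution b α xS Um Up) :
    AEStronglyMeasurable (twoStates xS Um Up) (volume.restrict (Ioo P.xL P.xR)) :=
  aestronglyMeasurable_twoStates
    (h.left.contDiffOn.continuousOn.aestronglyMeasurable measurableSet_Icc)
    (h.right.contDiffOn.continuousOn.aestronglyMeasurable measurableSet_Icc)

namespace IsShootingNhd

variable {α : Vec I} {xS ρ Λ : ℝ} {Um Up : ℝ → Vec n} {K : Set (Vec I × ℝ)}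

theorem eqOn_profile (hN : P.IsShootingNhd α xS Um Up ρ Λ K) {y : Vec I × ℝ} (hy : y ∈ K) :
    ∃ Um' Up' : ℝ → Vec n,
      P.IsShockSolution (P.shoot P.propagate (P.jump (Up xS)) y) y.1 y.2 Um' Up' ∧
      EqOn (P.profile P.propagate (P.jump (Up xS)) y) (twoStates y.2 Um' Up') (Ioo P.xL P.xR) ∧
      ‖Up' y.2 - Up xS‖ < ρ := by
  obtain ⟨Um', Up', hsol, hm, hp, hV⟩ := hN.sol y hy
  refine ⟨Um', Up', hsol, fun x hx => ?_, ?_⟩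
  · unfold profile twoStates
    split_ifs with h
    · exact hm ⟨hx.1.le, h⟩
    · exact hp ⟨(not_le.1 h).le, hx.2.le⟩
  · rw [hV, ← mem_ball_iff_norm]
    exact hN.back_mem y hy

/-- Lipschitz stability makes the shooting function injective. -/
theorem injOn_shoot (hN : P.IsShootingNhd α xS Um Up ρ Λ K)
    (hsep : 2 * ρ ≤ dist (Um xS) (Up xS)) {C δ : ℝ} (hρδ : ρ ≤ δ)
    (hst : ∀ (b₁ b₂ : Vec (I + 1)) (α₁ α₂ : Vec I) (x₁ x₂ : ℝ) (Um₁ Up₁ Um₂ Up₂ : ℝ → Vec n),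
      P.IsShockSolution b₁ α₁ x₁ Um₁ Up₁ → P.IsShockSolution b₂ α₂ x₂ Um₂ Up₂ →
      ‖α₁ - α‖ < δ → |x₁ - xS| < δ → ‖Up₁ x₁ - Up xS‖ < δ →
      ‖α₂ - α‖ < δ → |x₂ - xS| < δ → ‖Up₂ x₂ - Up xS‖ < δ →
      eLpNorm (fun x => twoStates x₁ Um₁ Up₁ x - twoStates x₂ Um₂ Up₂ x) 1
        (volume.restrict (Ioo P.xL P.xR)) ≤ ENNReal.ofReal (C * ‖b₁ - b₂‖)) :
    InjOn (P.shoot P.propagate (P.jump (Up xS))) K := by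
  have hae : ∀ {y y' : Vec I × ℝ} {Um₁ Up₁ Um₂ Up₂ : ℝ → Vec n}, y ∈ K → y' ∈ K →
      P.shoot P.propagate (P.jump (Up xS)) y = P.shoot P.propagate (P.jump (Up xS)) y' →
      P.IsShockSolution (P.shoot P.propagate (P.jump (Up xS)) y) y.1 y.2 Um₁ Up₁ →
      P.IsShockSolution (P.shoot P.propagate (P.jump (Up xS)) y') y'.1 y'.2 Um₂ Up₂ →
      ‖Up₁ y.2 - Up xS‖ < ρ → ‖Up₂ y'.2 - Up xS‖ < ρ →
      twoStates y.2 Um₁ Up₁ =ᵐ[volume.restrict (Ioo P.xL P.xR)] twoStates y'.2 Um₂ Up₂ := by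
    intro y y' Um₁ Up₁ Um₂ Up₂ hy hy' hG h₁ h₂ hV₁ hV₂
    have h := hst _ _ _ _ _ _ _ _ _ _ h₁ h₂ ((hN.near y hy).1.trans_le hρδ)
      ((hN.near y hy).2.trans_le hρδ) (hV₁.trans_le hρδ) ((hN.near y' hy').1.trans_le hρδ)
      ((hN.near y' hy').2.trans_le hρδ) (hV₂.trans_le hρδ)
    rw [hG, sub_self, norm_zero, mul_zero, ENNReal.ofReal_zero, nonpos_iff_eq_zero] at h
    have h0 := (eLpNorm_eq_zero_iff (h₁.aestronglyMeasurable.sub h₂.aestronglyMeasurable)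
      one_ne_zero).1 h
    filter_upwards [h0] with x hx
    exact sub_eq_zero.1 hx
  -- Between two distinct shock locations the right branch of one solution would coincide with the
  -- left branch of the other. At `y.2` the former is within `ρ` of `Up xS` and the latter within
  -- `ρ` of `Um xS`, but these states are at least `2 * ρ` apart.
  have hnlt : ∀ y ∈ K, ∀ y' ∈ K,
      P.shoot P.propagate (P.jump (Up xS)) y = P.shoot P.propagate (P.jump (Up xS)) y' →
      ¬ y.2 < y'.2 := by
    intro y hy y' hy' hG hlt
    obtain ⟨Um₁, Up₁, h₁, -, -, hV₁⟩ := hN.sol y hy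
    obtain ⟨Um₂, Up₂, h₂, hm₂, -, hV₂⟩ := hN.sol y' hy'
    have hb₁ := hN.back_mem y hy
    have hb₂ := hN.back_mem y' hy'
    rw [← hV₁, mem_ball_iff_norm] at hb₁
    rw [← hV₂, mem_ball_iff_norm] at hb₂
    have hall := hae hy hy' hG h₁ h₂ hb₁ hb₂
    have hsub : Icc y.2 y'.2 ⊆ Ioo P.xL P.xR := fun x hx =>
      ⟨h₁.mem_Ioo.1.trans_le hx.1, hx.2.trans_lt h₂.mem_Ioo.2⟩
    have heq : Up₁ =ᵐ[volume.restrict (Icc y.2 y'.2)] Um₂ := by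
      have hne : ∀ᵐ x ∂(volume.restrict (Icc y.2 y'.2)), x ≠ y.2 :=
        ae_restrict_of_ae (compl_mem_ae_iff.2 (measure_singleton y.2))
      filter_upwards [ae_restrict_of_ae_restrict_of_subset hsub hall, hne,
        ae_restrict_mem measurableSet_Icc] with x hx hxne hxI
      have : ¬ x ≤ y.2 := fun h => hxne (le_antisymm h hxI.1)
      simpa [twoStates, this, hxI.2] using hx
    have h := Measure.eqOn_Icc_of_ae_eq volume hlt.ne heq
      (h₁.right.contDiffOn.continuousOn.mono (Icc_subset_Icc_right h₂.mem_Ioo.2.le))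
      (h₂.left.contDiffOn.continuousOn.mono (Icc_subset_Icc_left h₁.mem_Ioo.1.le))
      (left_mem_Icc.2 hlt.le)
    have h' : P.propagate P.xL y.2 (P.UL y'.1) = Um₂ y.2 := hm₂ ⟨h₁.mem_Ioo.1.le, hlt.le⟩
    have hf := hN.front_mem _ (hN.swap y' hy' y hy)
    rw [h', ← h, Metric.mem_ball] at hf
    rw [← dist_eq_norm] at hb₁
    linarith [dist_triangle_left (Um xS) (Up xS) (Up₁ y.2)]
  intro y hy y' hy' hG
  have hx : y.2 = y'.2 :=
    le_antisymm (not_lt.1 (hnlt y' hy' y hy hG.symm)) (not_lt.1 (hnlt y hy y' hy' hG))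
  obtain ⟨Um₁, Up₁, h₁, -, -, hV₁⟩ := hN.sol y hy
  obtain ⟨Um₂, Up₂, h₂, -, -, hV₂⟩ := hN.sol y' hy'
  have hb₁ := hN.back_mem y hy
  have hb₂ := hN.back_mem y' hy'
  rw [← hV₁, mem_ball_iff_norm] at hb₁
  rw [← hV₂, mem_ball_iff_norm] at hb₂
  have hall := hae hy hy' hG h₁ h₂ hb₁ hb₂
  have hxI := h₁.mem_Ioo
  -- With a common shock location the left branches agree up to `xL`, and the parameters are read
  -- off from the boundary state.
  have heq : Um₁ =ᵐ[volume.restrict (Icc P.xL y.2)] Um₂ := by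
    rw [← restrict_Ioo_eq_restrict_Icc]
    filter_upwards [ae_restrict_of_ae_restrict_of_subset (Ioo_subset_Ioo_right hxI.2.le) hall,
      ae_restrict_mem measurableSet_Ioo] with x hx' hxm
    simpa [twoStates, ← hx, hxm.2.le] using hx'
  have h := Measure.eqOn_Icc_of_ae_eq volume hxI.1.ne heq h₁.left.contDiffOn.continuousOn
    (by rw [hx]; exact h₂.left.contDiffOn.continuousOn) (left_mem_Icc.2 hxI.1.le)
  rw [h₁.left_bc, h₂.left_bc] at h
  exact Prod.ext (hN.UL_inj y hy y' hy' h) hx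

/-- Perturbing the propagation and jump operators by `η` perturbs profiles and the shooting function
by a multiple of `η`. -/
theorem perturb (hN : P.IsShootingNhd α xS Um Up ρ Λ K) (hΛ : 0 ≤ Λ)
    {p : ℝ → ℝ → Vec n → Vec n} {φ : Vec n → Vec n} {δ η : ℝ} (hη : 0 ≤ η) (hρδ : 2 * ρ ≤ δ)
    (hηρ : (1 + Λ * (1 + Λ)) * η < ρ)
    (hp : ∀ x ∈ Icc P.xL (xS + δ), ∀ U ∈ Metric.ball (Um P.xL) δ,
      ‖p P.xL x U - P.propagate P.xL x U‖ ≤ η)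
    (hφ : ∀ U ∈ Metric.ball (Um xS) δ, ‖φ U - P.jump (Up xS) U‖ ≤ η)
    (hp' : ∀ x₁ ∈ Icc (xS - δ) (xS + δ), ∀ x₂ ∈ Icc x₁ P.xR, ∀ U ∈ Metric.ball (Up xS) δ,
      ‖p x₁ x₂ U - P.propagate x₁ x₂ U‖ ≤ η) {y : Vec I × ℝ} (hy : y ∈ K) :
    p P.xL y.2 (P.UL y.1) ∈ Metric.ball (Um xS) (2 * ρ) ∧
    φ (p P.xL y.2 (P.UL y.1)) ∈ Metric.ball (Up xS) (2 * ρ) ∧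
    p y.2 P.xR (φ (p P.xL y.2 (P.UL y.1))) ∈ Metric.ball (Up P.xR) (2 * ρ) ∧
    ‖P.shoot p φ y - P.shoot P.propagate (P.jump (Up xS)) y‖ ≤ Λ * ((1 + Λ * (1 + Λ)) * η) ∧
    ∀ x ∈ Ioo P.xL P.xR, ‖P.profile P.propagate (P.jump (Up xS)) y x - P.profile p φ y x‖ ≤
      (1 + Λ * (1 + Λ)) * η := by
  have hρ : 0 < ρ := lt_of_le_of_lt (by positivity) hηρ
  obtain ⟨-, hyS⟩ := hN.near y hy
  rw [abs_lt] at hyS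
  have hyI := hN.mem_Ioo y hy
  have hUL : P.UL y.1 ∈ Metric.ball (Um P.xL) δ :=
    Metric.ball_subset_ball (by linarith) (hN.UL_mem y hy)
  have hc1 : η ≤ (1 + Λ * (1 + Λ)) * η := by nlinarith [mul_nonneg hΛ hΛ, mul_nonneg hΛ hη, mul_nonneg (mul_nonneg hΛ hΛ) hη]
  have hc2 : (1 + Λ) * η ≤ (1 + Λ * (1 + Λ)) * η := by
    nlinarith [mul_nonneg (mul_nonneg hΛ hΛ) hη]
  have step : ∀ {A B C : Vec n} {τ : ℝ}, ‖A - B‖ ≤ τ → τ < ρ → B ∈ Metric.ball C ρ →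
      A ∈ Metric.ball C (2 * ρ) := by
    intro A B C τ h1 h2 h3
    rw [Metric.mem_ball] at h3 ⊢
    rw [← dist_eq_norm] at h1
    linarith [dist_triangle A B C]
  set W := P.propagate P.xL y.2 (P.UL y.1)
  set W' := p P.xL y.2 (P.UL y.1)
  set V := P.jump (Up xS) W
  set V' := φ W'
  have dbl : ∀ {A C : Vec n}, A ∈ Metric.ball C ρ → A ∈ Metric.ball C (2 * ρ) := fun h =>
    Metric.ball_subset_ball (by linarith) h
  -- The error is `η` in front of the shock, `(1 + Λ) * η` behind it, and `η + Λ * ((1 + Λ) * η)` on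
  -- the right branch. Each step applies the discrete and the exact operator to the same discrete
  -- state, so only Lipschitz constants of exact operators enter.
  have hW : ‖W' - W‖ ≤ η := hp y.2 ⟨hyI.1.le, by linarith⟩ _ hUL
  have hW' : W' ∈ Metric.ball (Um xS) (2 * ρ) := step hW (by linarith) (hN.front_mem y hy)
  have hV : ‖V' - V‖ ≤ (1 + Λ) * η := by
    have e1 := hφ W' (Metric.ball_subset_ball hρδ hW')
    have e2 := hN.jump_le W' hW' W (dbl (hN.front_mem y hy))
    have e3 : Λ * ‖W' - W‖ ≤ Λ * η := by gcongr
    have := norm_sub_le_norm_sub_add_norm_sub V' (P.jump (Up xS) W') V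
    linarith
  have hV' : V' ∈ Metric.ball (Up xS) (2 * ρ) := step hV (by linarith) (hN.back_mem y hy)
  have hright : ∀ x ∈ Icc y.2 P.xR, ‖p y.2 x V' - P.propagate y.2 x V‖ ≤
      (1 + Λ * (1 + Λ)) * η := by
    intro x hx
    have e1 := hp' y.2 ⟨by linarith, by linarith⟩ x hx V' (Metric.ball_subset_ball hρδ hV')
    have e2 := hN.propagate_le y hy V' hV' V (dbl (hN.back_mem y hy)) x hx
    have e3 : Λ * ‖V' - V‖ ≤ Λ * ((1 + Λ) * η) := by gcongr
    have := norm_sub_le_norm_sub_add_norm_sub (p y.2 x V') (P.propagate y.2 x V')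
      (P.propagate y.2 x V)
    linarith
  have hR := hright P.xR ⟨hyI.2.le, le_rfl⟩
  have hR' : p y.2 P.xR V' ∈ Metric.ball (Up P.xR) (2 * ρ) := step hR hηρ (hN.end_mem y hy)
  refine ⟨hW', hV', hR', ?_, fun x hx => ?_⟩
  · refine (hN.BR_le _ hR' _ (dbl (hN.end_mem y hy))).trans ?_
    gcongr
  · unfold profile twoStates
    rw [norm_sub_rev]
    split_ifs with h
    · exact (hp x ⟨hx.1.le, by linarith⟩ _ hUL).trans hc1
    · exact hright x ⟨(not_le.1 h).le, hx.2.le⟩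

theorem continuousOn_BR (hN : P.IsShootingNhd α xS Um Up ρ Λ K) :
    ContinuousOn P.BR (Metric.ball (Up P.xR) (2 * ρ)) := by
  refine (LipschitzOnWith.of_dist_le' (K := Λ) fun U hU U' hU' => ?_).continuousOn
  rw [dist_eq_norm, dist_eq_norm]
  exact hN.BR_le U hU U' hU'

end IsShootingNhd

theorem memLp_component {f : ℝ → Vec n} {μ : Measure ℝ} {c : ℝ} (hf : AEStronglyMeasurable f μ)
    (hc : eLpNorm f 1 μ ≤ ENNReal.ofReal c) (i : Fin n) :
    MemLp (fun x => f x i) 1 μ ∧ eLpNorm (fun x => f x i) 1 μ ≤ ENNReal.ofReal c := by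
  have h : eLpNorm (fun x => f x i) 1 μ ≤ ENNReal.ofReal c :=
    (eLpNorm_mono fun x => PiLp.norm_apply_le (f x) i).trans hc
  exact ⟨⟨(EuclideanSpace.proj (𝕜 := ℝ) i).continuous.comp_aestronglyMeasurable hf,
    h.trans_lt ENNReal.ofReal_lt_top⟩, h⟩

theorem eLpNorm_one_restrict_Ioo_le {f : ℝ → Vec n} {A B c : ℝ}
    (hf : ∀ x ∈ Ioo A B, ‖f x‖ ≤ c) :
    eLpNorm f 1 (volume.restrict (Ioo A B)) ≤ ENNReal.ofReal (c * (B - A)) := by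
  rcases lt_or_ge A B with hAB | hAB
  · have hc : 0 ≤ c := (norm_nonneg _).trans (hf ((A + B) / 2) ⟨by linarith, by linarith⟩)
    refine (eLpNorm_le_of_ae_bound (C := c) (ae_restrict_of_forall_mem measurableSet_Ioo hf)).trans
      (le_of_eq ?_)
    simp [ENNReal.ofReal_mul hc, mul_comm]
  · simp [Ioo_eq_empty (not_lt.2 hAB)]

end SteadyProblem

/-! ### Existence of the discrete solution and its error. -/

theorem theorem1 {n I : ℕ} (P : SteadyProblem n I) (α : Vec I) (xS : ℝ) (Um Up : ℝ → Vec n)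
    (hP : P.WellPosed α xS Um Up) (k : ℝ) (hk : 0 < k)
    (Ph : ℝ → ℝ → ℝ → Vec n → Vec n) (Φh : ℝ → Vec n → Vec n)
    (hPh : P.IsApproximation xS Um Up k Ph Φh) :
    ∃ C h₁ : ℝ, 0 < h₁ ∧ ∀ h ∈ Ioo 0 h₁, ∃ y : Vec I × ℝ,
      y.2 ∈ Ioo P.xL P.xR ∧ P.shoot (Ph h) (Φh h) y = 0 ∧
      ∀ U : ℝ → Vec n,
        (U = P.profile (Ph h) (Φh h) y ∨ U = P.profile P.propagate (P.jump (Up xS)) y) →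
        ∀ i : Fin n,
          MemLp (fun x => twoStates xS Um Up x i - U x i) 1
            (volume.restrict (Ioo P.xL P.xR)) ∧
          eLpNorm (fun x => twoStates xS Um Up x i - U x i) 1
            (volume.restrict (Ioo P.xL P.xR)) ≤ ENNReal.ofReal (C * h ^ k) := by
  obtain ⟨δ, h₀, M, hδ, hh₀, happ⟩ := hPh
  obtain ⟨C, δs, hδs, hst⟩ := hP.stable
  have hsep : 0 < dist (Um xS) (Up xS) := dist_pos.2 hP.sol.lax.ne
  -- The three bounds keep discrete states where the operators are accurate, solutions where
  -- stability holds, and the two sides of the shock apart.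
  obtain ⟨ρ, Λ, K, hρ, hρ₀, hΛ, hN⟩ := hP.exists_shootingNhd
    (ρ₀ := min (δ / 2) (min δs (dist (Um xS) (Up xS) / 2))) (by positivity)
  have hρδ : 2 * ρ ≤ δ := by linarith [hρ₀.trans (min_le_left _ _)]
  have hρs : ρ ≤ δs := hρ₀.trans ((min_le_right _ _).trans (min_le_left _ _))
  have hρd : 2 * ρ ≤ dist (Um xS) (Up xS) := by
    linarith [hρ₀.trans ((min_le_right _ _).trans (min_le_right _ _))]
  let e : (Vec I × ℝ) ≃L[ℝ] Vec (I + 1) := ContinuousLinearEquiv.ofFinrankEq (by simp)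
  obtain ⟨ε, hε, hzero⟩ := exists_zero_of_near_injOn e hN.mem_nhds hN.shoot_continuousOn
    (hN.injOn_shoot hρd hρs hst) hN.shoot_eq_zero
  set c := 1 + Λ * (1 + Λ)
  have hc : 0 < c := by positivity
  obtain ⟨h₁, hh₁, hh₁₀, hsmall⟩ : ∃ h₁ > 0, h₁ ≤ h₀ ∧ ∀ h ∈ Ioo 0 h₁,
      c * (|M| * h ^ k) < ρ ∧ Λ * (c * (|M| * h ^ k)) ≤ ε := by
    have hlim : Tendsto (fun h : ℝ => h ^ k) (𝓝 0) (𝓝 0) := by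
      have := (Real.continuousAt_rpow_const 0 k (Or.inr hk.le)).tendsto
      rwa [Real.zero_rpow hk.ne'] at this
    have l1 : Tendsto (fun h : ℝ => c * (|M| * h ^ k)) (𝓝 0) (𝓝 0) := by
      simpa using (hlim.const_mul |M|).const_mul c
    have l2 : Tendsto (fun h : ℝ => Λ * (c * (|M| * h ^ k))) (𝓝 0) (𝓝 0) := by
      simpa using l1.const_mul Λ
    obtain ⟨r, hr, hball⟩ := Metric.eventually_nhds_iff_ball.1
      ((l1.eventually_lt_const hρ).and (l2.eventually_le_const hε))
    refine ⟨min r h₀, lt_min hr hh₀, min_le_right _ _, fun h hh => hball h ?_⟩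
    rw [mem_ball_zero_iff, Real.norm_eq_abs, abs_of_pos hh.1]
    exact hh.2.trans_le (min_le_left _ _)
  -- The first summand is the stability bound for a boundary residual of at most `Λ * (c * η)`, the
  -- second the integral over the interval of the uniform profile error `c * η`.
  refine ⟨(|C| * (Λ * c) + c * (P.xR - P.xL)) * |M|, h₁, hh₁, fun h hh => ?_⟩
  obtain ⟨a1, a2, a3, ⟨L1, l1⟩, ⟨L2, l2⟩, ⟨L3, l3⟩, m1, m2⟩ := happ h ⟨hh.1, hh.2.trans_le hh₁₀⟩
  obtain ⟨hs1, hs2⟩ := hsmall h hh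
  set η := |M| * h ^ k
  have hhk : 0 ≤ h ^ k := Real.rpow_nonneg hh.1.le k
  have hη : 0 ≤ η := by positivity
  have hMη : M * h ^ k ≤ η := by
    simp only [η]
    gcongr
    exact le_abs_self M
  have hpert := fun y (hy : y ∈ K) => hN.perturb hΛ hη hρδ hs1
    (fun x hx U hU => (a1 x hx U hU).trans hMη) (fun U hU => (a2 U hU).trans hMη)
    (fun x₁ hx₁ x₂ hx₂ U hU => (a3 x₁ hx₁ x₂ hx₂ U hU).trans hMη) hy
  have hyS : ∀ y ∈ K, y.2 ∈ Icc (xS - δ) (xS + δ) := by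
    intro y hy
    have := abs_lt.1 (hN.near y hy).2
    exact ⟨by linarith, by linarith⟩
  have hUL : ∀ y ∈ K, P.UL y.1 ∈ Metric.ball (Um P.xL) δ := fun y hy =>
    Metric.ball_subset_ball (by linarith) (hN.UL_mem y hy)
  -- The `h`-dependent Lipschitz constants are used only for the continuity of the discrete shooting
  -- function.
  have hcW : ContinuousOn (fun y : Vec I × ℝ => Ph h P.xL y.2 (P.UL y.1)) K :=
    l1.continuousOn.comp (continuousOn_snd.prodMk hN.UL_continuousOn)
      fun y hy => ⟨hyS y hy, hUL y hy⟩
  have hcV : ContinuousOn (fun y : Vec I × ℝ => Φh h (Ph h P.xL y.2 (P.UL y.1))) K :=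
    l2.continuousOn.comp hcW fun y hy => Metric.ball_subset_ball hρδ (hpert y hy).1
  have hcR : ContinuousOn (fun y : Vec I × ℝ =>
      Ph h y.2 P.xR (Φh h (Ph h P.xL y.2 (P.UL y.1)))) K :=
    l3.continuousOn.comp (continuousOn_snd.prodMk hcV)
      fun y hy => ⟨hyS y hy, Metric.ball_subset_ball hρδ (hpert y hy).2.1⟩
  have hcG : ContinuousOn (P.shoot (Ph h) (Φh h)) K :=
    hN.continuousOn_BR.comp hcR fun y hy => (hpert y hy).2.2.1
  obtain ⟨y, hy, hy0⟩ := hzero _ hcG fun y hy => (hpert y hy).2.2.2.1.trans hs2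
  refine ⟨y, hN.mem_Ioo y hy, hy0, ?_⟩
  obtain ⟨-, hVy, -, hGy, hprof⟩ := hpert y hy
  obtain ⟨Um', Up', hsol', hEq, hUp'⟩ := hN.eqOn_profile hy
  set μ := volume.restrict (Ioo P.xL P.xR)
  have hexact : AEStronglyMeasurable (P.profile P.propagate (P.jump (Up xS)) y) μ :=
    hsol'.aestronglyMeasurable.congr
      ((ae_restrict_of_forall_mem measurableSet_Ioo hEq).mono fun x hx => hx.symm)
  have hdiscrete : AEStronglyMeasurable (P.profile (Ph h) (Φh h) y) μ :=
    SteadyProblem.aestronglyMeasurable_twoStates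
      ((m1 _ (hUL y hy)).mono_measure
        (Measure.restrict_mono (Icc_subset_Icc_right (hyS y hy).2) le_rfl))
      (m2 y.2 (hyS y hy) _ (Metric.ball_subset_ball hρδ hVy))
  have hex := hP.sol.aestronglyMeasurable
  have hE : eLpNorm (fun x => twoStates xS Um Up x - P.profile P.propagate (P.jump (Up xS)) y x) 1 μ
      ≤ ENNReal.ofReal (|C| * (Λ * (c * η))) := by
    -- The second solution has right datum `G(y)`, which is the discretization error of the shooting
    -- function because the discrete one vanishes at `y`.
    have h1 := hst _ _ _ _ _ _ _ _ _ _ hP.sol hsol' (by simpa using hδs) (by simpa using hδs)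
      (by simpa using hδs) ((hN.near y hy).1.trans_le hρs) ((hN.near y hy).2.trans_le hρs)
      (hUp'.trans_le hρs)
    rw [eLpNorm_congr_ae (g := fun x => twoStates xS Um Up x - twoStates y.2 Um' Up' x)
      ((ae_restrict_of_forall_mem measurableSet_Ioo hEq).mono fun x hx => by
        change _ - _ = _ - _
        rw [hx])]
    refine h1.trans (ENNReal.ofReal_le_ofReal ?_)
    rw [hy0, zero_sub, norm_neg] at hGy
    rw [zero_sub, norm_neg]
    gcongr
    exact le_abs_self C
  have hD : eLpNorm (fun x => P.profile P.propagate (P.jump (Up xS)) y x -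
      P.profile (Ph h) (Φh h) y x) 1 μ ≤ ENNReal.ofReal (c * η * (P.xR - P.xL)) :=
    SteadyProblem.eLpNorm_one_restrict_Ioo_le hprof
  have hT : 0 < P.xR - P.xL := sub_pos.2 P.xL_lt_xR
  have hCe : (|C| * (Λ * c) + c * (P.xR - P.xL)) * |M| * h ^ k
      = |C| * (Λ * (c * η)) + c * η * (P.xR - P.xL) := by
    simp only [η]; ring
  rw [hCe]
  rintro U (rfl | rfl) i
  · refine SteadyProblem.memLp_component (f := fun x => twoStates xS Um Up x -
      P.profile (Ph h) (Φh h) y x) (hex.sub hdiscrete) ?_ i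
    have hsum := eLpNorm_add_le (hex.sub hexact) (hexact.sub hdiscrete) le_rfl
    rw [sub_add_sub_cancel] at hsum
    rw [ENNReal.ofReal_add (by positivity) (by positivity)]
    exact hsum.trans (add_le_add hE hD)
  · refine SteadyProblem.memLp_component (f := fun x => twoStates xS Um Up x -
      P.profile P.propagate (P.jump (Up xS)) y x) (hex.sub hexact) ?_ i
    refine hE.trans (ENNReal.ofReal_le_ofReal ?_)
    have : 0 ≤ c * η * (P.xR - P.xL) := by positivity
    linarith
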